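/- Let $\Omega\subset\mathbb R^2$ be compact and convex, $h>0$, and let $U:\Omega\to\mathbb R$ be convex. For $\theta\in\mathbb R$, $\xi\in\mathbb R^2$ let $R_\theta$ be the rotation of angle $\theta$ and $X=X_\theta^\xi:=\Omega\cap hR_\theta(\xi+\mathbb Z^2)$. Put $|\Omega|_h:=h^{-2}|\Omega|$ and $\mathrm{diam}_h(\Omega):=h^{-1}\mathrm{diam}(\Omega)$. A vector $e\in\mathbb Z^2$ is irreducible if its coordinates are coprime. Every irreducible $e$ with $\|e\|>1$ can be written in exactly one way as $e=f+g$ with $f,g\in\mathbb Z^2$, $\det(f,g)=1$ and $\langle f,g\rangle\ge 0$; the vectors $f,g$ are the parents of $e$. (Unit vectors have no parents.) For $x\in X$ let $\mathcal V_{\max}(x)$ be the set of irreducible $e\in\mathbb Z^2$ with $x+hR_\theta e\in X$. A family of stencils on $X$ is a collection $\mathcal V=(\mathcal V(x))_{x\in X}$ of sets $\mathcal V(x)\subset\mathcal V_{\max}(x)$ such that, for each $x\in X$, (Stability) every parent of an element of $\mathcal V(x)$ which lies in $\mathcal V_{\max}(x)$ lies in $\mathcal V(x)$, and (Visibility) $\mathcal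 V(x)$ and $\mathcal V_{\max}(x)$ generate the same convex cone (the cone generated by $\emptyset$ being $\{0\}$). Families of stencils are ordered by inclusion, and $\#(\mathcal V):=\sum_{x\in X}\#\mathcal V(x)$. The cone $\mathrm{Conv}(\mathcal V)$ consists of all $u:X\to\mathbb R$ such that for all $x\in X$ (where $f,g$ are the parents of $e$): - $u(x+hR_\theta e)-2u(x)+u(x-hR_\theta e)\ge 0$ for all $e\in\mathcal V(x)$ such that all the points involved are in $X$; - $u(x+hR_\theta e)+u(x-hR_\theta f)+u(x-hR_\theta g)-3u(x)\ge 0$ for all $e\in\mathcal V(x)$ with $\|e\|>1$ such that all the points involved are in $X$; - $u(x+hR_\theta e)-u(x+hR_\theta f)-u(x+hR_\theta g)+u(x)\ge 0$ for all $e\in\mathcal V_{\max}(x)\setminus\mathcal V(x)$ with $\|e\|>1$ and $f,g\in\mathcal V(x)$. Theorem. Assume $\mathrm{diam}_h(\Omega)\ge 2$. Then for all $\theta\in\mathbb R$, $\xi\in\mathbb R^2$ there is a smallest (for inclusion) family of stencils $\mathcal V_\theta^\xi$ on $X_\theta^\xi$ such that $U_{|X_\theta^\xi}\in\mathrm{Conv}(\mathcal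 V_\theta^\xi)$; it is finite, the function $(\xi,\theta)\mapsto\#(\mathcal V_\theta^\xi)$ is integrable on $[0,1]^2\times[0,\pi/2]$, and $$\int_{[0,1]^2}\int_0^{\pi/2}\#(\mathcal V_\theta^\xi)\,d\theta\,d\xi\ \le\ C\,|\Omega|_h\,(\ln\mathrm{diam}_h(\Omega))^2,$$ where $C>0$ is a universal constant (independent of $\Omega$, $h$ and $U$). -/

import Mathlib

open MeasureTheory

noncomputable section

/-- The Euclidean plane. -/
abbrev Plane : Type := EuclideanSpace ℝ (Fin 2)

/-- The lattice of integer vectors, as abstract offsets. -/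
abbrev IntVec : Type := ℤ × ℤ

/-- The inclusion of the integer lattice in the plane. -/
def latticeVec (e : IntVec) : Plane := !₂[(e.1 : ℝ), (e.2 : ℝ)]

/-- The rotation of angle `θ`. -/
def rotate (θ : ℝ) (v : Plane) : Plane :=
  !₂[Real.cos θ * v 0 - Real.sin θ * v 1, Real.sin θ * v 0 + Real.cos θ * v 1]

/-- The grid `Ω ∩ h R_θ (ξ + ℤ²)`. -/
def gridPoints (Ω : Set Plane) (h θ : ℝ) (ξ : Plane) : Set Plane :=
  {x | x ∈ Ω ∧ ∃ k : IntVec, x = h • rotate θ (ξ + latticeVec k)}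

/-- The point `x + h R_θ e`, reached from `x` by the lattice offset `e`. -/
def shift (h θ : ℝ) (x : Plane) (e : IntVec) : Plane := x + h • rotate θ (latticeVec e)

/-- Irreducible lattice vectors: those with coprime coordinates. -/
def IrreducibleVec (e : IntVec) : Prop := Int.gcd e.1 e.2 = 1

/-- `(f, g)` is the direct acute basis of `ℤ²` with `e = f + g`, so `f` and `g` are the parents
of `e`. Irreducible vectors of norm `> 1` have exactly one such pair, unit vectors have none. -/
def IsParentPair (f g e : IntVec) : Prop :=
  f.1 * g.2 - f.2 * g.1 = 1 ∧ 0 ≤ f.1 * g.1 + f.2 * g.2 ∧ e = f + g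

/-- `f` is one of the two parents of `e`. -/
def IsParent (f e : IntVec) : Prop := ∃ g, IsParentPair f g e ∨ IsParentPair g f e

/-- The convex cone generated by a set of lattice vectors (`{0}` for the empty set). -/
def latticeCone (A : Set IntVec) : Set Plane :=
  (PointedCone.hull ℝ (latticeVec '' A) : Set Plane)

/-- The maximal stencils: the pairs `(x, e)` with `x` and `x + h R_θ e` in the grid and `e`
irreducible. Families of stencils are identified with sets of pairs `(x, e)`. -/
def maxStencils (Ω : Set Plane) (h θ : ℝ) (ξ : Plane) : Set (Plane × IntVec) :=
  {p | p.1 ∈ gridPoints Ω h θ ξ ∧ IrreducibleVec p.2 ∧ shift h θ p.1 p.2 ∈ gridPoints Ω h θ ξ}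

/-- The stencil at the point `x` of a family of stencils. -/
def stencilAt (V : Set (Plane × IntVec)) (x : Plane) : Set IntVec := {e | (x, e) ∈ V}

/-- `V` is a family of stencils on the grid `Ω ∩ h R_θ (ξ + ℤ²)`. -/
structure IsStencils (Ω : Set Plane) (h θ : ℝ) (ξ : Plane) (V : Set (Plane × IntVec)) :
    Prop where
  subset_max : V ⊆ maxStencils Ω h θ ξ
  stability : ∀ x e f, (x, e) ∈ V → IsParent f e → (x, f) ∈ maxStencils Ω h θ ξ → (x, f) ∈ V
  visibility : ∀ x ∈ gridPoints Ω h θ ξ,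
    latticeCone (stencilAt V x) = latticeCone (stencilAt (maxStencils Ω h θ ξ) x)

/-- The linear form `S_x^e` (segments). -/
def segmentForm (h θ : ℝ) (x : Plane) (e : IntVec) (u : Plane → ℝ) : ℝ :=
  u (shift h θ x e) - 2 * u x + u (shift h θ x (-e))

/-- The linear form `T_x^e` (triangles), where `f`, `g` are the parents of `e`. -/
def triangleForm (h θ : ℝ) (x : Plane) (e f g : IntVec) (u : Plane → ℝ) : ℝ :=
  u (shift h θ x e) + u (shift h θ x (-f)) + u (shift h θ x (-g)) - 3 * u x

/-- The linear form `P_x^e` (parallelograms), where `f`, `g` are the parents of `e`. -/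
def parallelogramForm (h θ : ℝ) (x : Plane) (e f g : IntVec) (u : Plane → ℝ) : ℝ :=
  u (shift h θ x e) - u (shift h θ x f) - u (shift h θ x g) + u x

/-- The restriction of `u` to the grid belongs to the cone attached to the stencils `V`: all forms
`S_x^e` and `T_x^e` with `(x, e) ∈ V` that are supported on the grid, and all forms `P_x^e` with `e`
a candidate for refinement at `x`, are non-negative. Only values of `u` at grid points are used. -/
structure InStencilCone (Ω : Set Plane) (h θ : ℝ) (ξ : Plane) (V : Set (Plane × IntVec))
    (u : Plane → ℝ) : Prop where
  segment : ∀ x e, (x, e) ∈ V → shift h θ x (-e) ∈ gridPoints Ω h θ ξ →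
    0 ≤ segmentForm h θ x e u
  triangle : ∀ x e f g, (x, e) ∈ V → IsParentPair f g e →
    shift h θ x (-f) ∈ gridPoints Ω h θ ξ → shift h θ x (-g) ∈ gridPoints Ω h θ ξ →
    0 ≤ triangleForm h θ x e f g u
  parallelogram : ∀ x e f g, (x, e) ∈ maxStencils Ω h θ ξ → (x, e) ∉ V → IsParentPair f g e →
    (x, f) ∈ V → (x, g) ∈ V → 0 ≤ parallelogramForm h θ x e f g u

/-- The families of stencils whose cone contains the restriction of `u` to the grid. -/
def admissibleStencils (Ω : Set Plane) (h θ : ℝ) (ξ : Plane) (u : Plane → ℝ) :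
    Set (Set (Plane × IntVec)) :=
  {V | IsStencils Ω h θ ξ V ∧ InStencilCone Ω h θ ξ V u}

/-- The minimal stencils whose cone contains the restriction of `u` to the grid, as the
intersection of all such families of stencils. -/
def minimalStencils (Ω : Set Plane) (h θ : ℝ) (ξ : Plane) (u : Plane → ℝ) :
    Set (Plane × IntVec) :=
  ⋂₀ admissibleStencils Ω h θ ξ u

/-- The square `[0,1]²` of offsets. -/
def unitSquare : Set Plane := {ξ | ∀ i, ξ i ∈ Set.Icc (0 : ℝ) 1}

end

/-! The minimal family is explicit. Let `e` belong to the stencil at `x` unless both parents `f`,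
`g` of `e` are available at `x` and the parallelogram form `P_x^e(U)` is nonnegative
(`refinementStencils`). Segment and triangle forms of a convex `U` are always nonnegative, so only
the parallelogram forms matter. This family is stable: if `f₁`, `f₂` are the parents of `f`, then `g
= f₂ + k f` and `e = f₂ + (k + 1) f` with `k ≥ 0`, and monotonicity of the increments of `U` along
this line turns `P_x^e(U) < 0` into `P_x^f(U) < 0` (`parallelogramForm_left_neg` and its mirror
image). It is visible because an omitted vector is the sum of two shorter available ones.

It is also the smallest family. Let `V` be admissible and suppose that `V` omits `e`. Visibility and
Carathéodory give elements of `V` on both sides of `e`, and a descent along parents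
(`mem_or_parents_mem`) shows that both parents of `e` are available. By stability and induction on
the norm they lie in `V`, so admissibility forces `P_x^e(U) ≥ 0`, and `e` is omitted by the explicit
family too.

For the count, unfolding the average over offsets gives `h⁻²` times the sum over `e` of the measure
of the pairs `(x, θ)` for which `e` is refined at `x`. Change variables to the centre `c = x + (h/2)
R_θ e`. Put `φ(v) = U(c + v) + U(c - v)`, which is even and convex. The parallelogram at `x` has
half-diagonals `A_θ = (h/2) R_θ e` and `B_θ = (h/2) R_θ (f - g)`, and negativity of its form reads
`φ(A_θ) < φ(B_θ)`. If two refined angles `α`, `β` with the same centre were far apart, `B_α` and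
`B_β` would lie in the convex hull of `±A_α`, `±A_β`, which is impossible for the angle maximising
`φ(A)`. Hence the refined angles fill a set of measure at most `π / min(⟨f, e⟩, ⟨g, e⟩)`
(`IsRefined.abs_sin_mul_lt`, `volume_refined_angles_le`).

It remains to sum `1/⟨f, e⟩` and `1/⟨g, e⟩` over `e`. For a given parent `f`, the vectors `e` differ
by multiples of `f`, so the sum is at most `∑_f |f|⁻² ∑_k k⁻¹`, a product of two logarithms
(`sum_one_div_ldot_parent_le`). -/

/-! ### Arithmetic of acute lattice bases and parents. -/

/-- The determinant of two lattice vectors. -/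
def ldet (a b : IntVec) : ℤ := a.1 * b.2 - a.2 * b.1

/-- The scalar product of two lattice vectors. -/
def ldot (a b : IntVec) : ℤ := a.1 * b.1 + a.2 * b.2

theorem ldot_sq_add_ldet_sq (a b : IntVec) :
    ldot a b ^ 2 + ldet a b ^ 2 = ldot a a * ldot b b := by
  simp only [ldot, ldet]; ring

theorem ldot_comm (a b : IntVec) : ldot a b = ldot b a := by
  simp only [ldot]; ring

theorem ldet_swap (a b : IntVec) : ldet a b = -ldet b a := by
  simp only [ldet]; ring

theorem ldet_self (a : IntVec) : ldet a a = 0 := by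
  simp only [ldet]; ring

theorem ldot_self_nonneg (a : IntVec) : 0 ≤ ldot a a := by
  simp only [ldot]; nlinarith [mul_self_nonneg a.1, mul_self_nonneg a.2]

theorem ldet_add_left (a b c : IntVec) : ldet (a + b) c = ldet a c + ldet b c := by
  simp only [ldet, Prod.fst_add, Prod.snd_add]; ring

theorem ldet_add_right (a b c : IntVec) : ldet c (a + b) = ldet c a + ldet c b := by
  simp only [ldet, Prod.fst_add, Prod.snd_add]; ring

theorem ldot_add_left (a b c : IntVec) : ldot (a + b) c = ldot a c + ldot b c := by
  simp only [ldot, Prod.fst_add, Prod.snd_add]; ring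

theorem ldot_add_right (a b c : IntVec) : ldot c (a + b) = ldot c a + ldot c b := by
  simp only [ldot, Prod.fst_add, Prod.snd_add]; ring

theorem ldot_smul_right (n : ℤ) (a c : IntVec) : ldot c (n • a) = n * ldot c a := by
  simp only [ldot, Prod.smul_fst, Prod.smul_snd, smul_eq_mul]; ring

/-- Cramer's rule. -/
theorem ldet_smul_eq (a b c : IntVec) : ldet a b • c = ldet c b • a + ldet a c • b := by
  ext <;> simp only [ldet, Prod.smul_fst, Prod.smul_snd, Prod.fst_add, Prod.snd_add,
    smul_eq_mul] <;> ring

/-- Cramer's rule, paired with a third vector. -/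
theorem ldet_mul_ldet (a b c d : IntVec) :
    ldet a b * ldet c d = ldet c b * ldet a d + ldet a c * ldet b d := by
  simp only [ldet]; ring

theorem ldot_self_mul_ldet (e a b : IntVec) :
    ldot e e * ldet a b = ldot e a * ldet e b - ldet e a * ldot e b := by
  simp only [ldet, ldot]; ring

theorem irreducibleVec_of_ldet_eq_one {a b : IntVec} (h : ldet a b = 1) : IrreducibleVec a := by
  rw [IrreducibleVec, ← Int.isCoprime_iff_gcd_eq_one]
  exact ⟨b.2, -b.1, by simp only [ldet] at h; linarith⟩

theorem irreducibleVec_of_ldet_eq_one' {a b : IntVec} (h : ldet a b = 1) : IrreducibleVec b := by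
  rw [IrreducibleVec, ← Int.isCoprime_iff_gcd_eq_one]
  exact ⟨-a.2, a.1, by simp only [ldet] at h; linarith⟩

theorem IrreducibleVec.ldot_self_pos {e : IntVec} (he : IrreducibleVec e) : 0 < ldot e e := by
  rcases (ldot_self_nonneg e).lt_or_eq with h | h
  · exact h
  · exfalso
    simp only [ldot] at h
    have h1 : e.1 = 0 := by nlinarith [mul_self_nonneg e.1, mul_self_nonneg e.2]
    have h2 : e.2 = 0 := by nlinarith [mul_self_nonneg e.1, mul_self_nonneg e.2]
    simp [IrreducibleVec, h1, h2] at he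

/-- Vectors with the same determinant against a primitive vector `f` differ by a multiple of `f`. -/
theorem exists_eq_add_smul_of_ldet_eq {f g a b : IntVec} (hfg : ldet f g = 1)
    (h : ldet f a = ldet f b) : ∃ k : ℤ, a = b + k • f := by
  refine ⟨ldet a g - ldet b g, ?_⟩
  have ha := ldet_smul_eq f g a
  have hb := ldet_smul_eq f g b
  rw [hfg, one_smul] at ha hb
  conv_lhs => rw [ha, h]
  conv_rhs => rw [hb]
  have : ldet (ldet b g • f + ldet f b • g) g = ldet b g := by rw [← hb]
  rw [this, sub_smul]
  abel

theorem IsParentPair.ldet_eq_one {f g e : IntVec} (h : IsParentPair f g e) : ldet f g = 1 := h.1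

theorem IsParentPair.ldot_nonneg {f g e : IntVec} (h : IsParentPair f g e) : 0 ≤ ldot f g := h.2.1

theorem IsParentPair.irreducible_left {f g e : IntVec} (h : IsParentPair f g e) :
    IrreducibleVec f := irreducibleVec_of_ldet_eq_one h.1

theorem IsParentPair.irreducible_right {f g e : IntVec} (h : IsParentPair f g e) :
    IrreducibleVec g := irreducibleVec_of_ldet_eq_one' h.1

theorem IsParentPair.ldet_left {f g e : IntVec} (h : IsParentPair f g e) : ldet f e = 1 := by
  rw [h.2.2, ldet_add_right, ldet_self, zero_add]; exact h.1

theorem IsParentPair.ldet_right {f g e : IntVec} (h : IsParentPair f g e) : ldet e g = 1 := by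
  rw [h.2.2, ldet_add_left, ldet_self, add_zero]; exact h.1

theorem IsParentPair.ldot_self {f g e : IntVec} (h : IsParentPair f g e) :
    ldot e e = ldot f f + ldot g g + 2 * ldot f g := by
  rw [h.2.2, ldot_add_left, ldot_add_right, ldot_add_right, ldot_comm g f]; ring

theorem IsParentPair.ldot_left {f g e : IntVec} (h : IsParentPair f g e) :
    ldot f e = ldot f f + ldot f g := by
  rw [h.2.2, ldot_add_right]

theorem IsParentPair.ldot_right {f g e : IntVec} (h : IsParentPair f g e) :
    ldot g e = ldot g g + ldot f g := by
  rw [h.2.2, ldot_add_right, ldot_comm g f]; ring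

theorem IsParentPair.ldot_left_pos {f g e : IntVec} (h : IsParentPair f g e) : 0 < ldot f e := by
  have := h.irreducible_left.ldot_self_pos
  have := h.ldot_nonneg
  rw [h.ldot_left]; omega

theorem IsParentPair.ldot_right_pos {f g e : IntVec} (h : IsParentPair f g e) : 0 < ldot g e := by
  have := h.irreducible_right.ldot_self_pos
  have := h.ldot_nonneg
  rw [h.ldot_right]; omega

theorem IsParentPair.ldot_self_left_lt {f g e : IntVec} (h : IsParentPair f g e) :
    ldot f f < ldot e e := by
  have := h.irreducible_right.ldot_self_pos
  have := h.ldot_nonneg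
  rw [h.ldot_self]; omega

theorem IsParentPair.ldot_self_right_lt {f g e : IntVec} (h : IsParentPair f g e) :
    ldot g g < ldot e e := by
  have := h.irreducible_left.ldot_self_pos
  have := h.ldot_nonneg
  rw [h.ldot_self]; omega

/-- Bézout gives a vector of determinant 1 against `e`, and reduction modulo `e` brings its product
with `e` into `[0, |e|²)`. Lagrange's identity `⟨f, e⟩² + 1 = |f|² |e|²` then excludes `⟨f, e⟩ = 0`
and forces `|f|² ≤ ⟨f, e⟩`, which is acuteness of `(f, e - f)`. -/
theorem exists_isParentPair {e : IntVec} (he : IrreducibleVec e) (h1 : 1 < ldot e e) :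
    ∃ f g, IsParentPair f g e := by
  have hc : IsCoprime e.1 e.2 := Int.isCoprime_iff_gcd_eq_one.2 he
  obtain ⟨a, b, hab⟩ := hc
  set f₀ : IntVec := (b, -a) with hf₀
  have hdet₀ : ldet f₀ e = 1 := by simp only [ldet, hf₀]; linarith
  set E := ldot e e with hE
  set f : IntVec := f₀ + (-(ldot f₀ e / E)) • e with hf
  have hdet : ldet f e = 1 := by
    simp only [ldet, hf, Prod.fst_add, Prod.snd_add, Prod.smul_fst, Prod.smul_snd, smul_eq_mul]
      at hdet₀ ⊢
    linarith
  have hdot : ldot f e = ldot f₀ e % E := by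
    rw [hf, ldot_add_left, ldot_comm (_ • e), ldot_smul_right, Int.emod_def, ← hE]; ring
  have hm0 : 0 ≤ ldot f e := hdot ▸ Int.emod_nonneg _ (by omega)
  have hm1 : ldot f e < E := hdot ▸ Int.emod_lt_of_pos _ (by omega)
  have hlag := ldot_sq_add_ldet_sq f e
  rw [hdet, ← hE] at hlag
  have hm2 : 0 < ldot f e := by
    rcases hm0.lt_or_eq with h | h
    · exact h
    · rw [← h] at hlag
      have := Int.eq_one_or_neg_one_of_mul_eq_one' (show ldot f f * E = 1 by linarith)
      omega
  refine ⟨f, e - f, ?_, ?_, by abel⟩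
  · change ldet f (e - f) = 1
    rw [sub_eq_add_neg, ldet_add_right, hdet]
    simp only [ldet, Prod.fst_neg, Prod.snd_neg]; ring
  · change 0 ≤ ldot f (e - f)
    have h2 : ldot f (e - f) = ldot f e - ldot f f := by
      simp only [ldot, Prod.fst_sub, Prod.snd_sub]; ring
    rw [h2]
    by_contra hneg
    push Not at hneg
    nlinarith

/-- Two candidates for the first parent differ by a multiple of `e`, and both have a product with
`e` strictly between `0` and `|e|²`. -/
theorem IsParentPair.unique {f g f' g' e : IntVec} (h : IsParentPair f g e)
    (h' : IsParentPair f' g' e) : f = f' ∧ g = g' := by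
  have hd : ldet e f = ldet e f' := by
    rw [ldet_swap e f, ldet_swap e f', h.ldet_left, h'.ldet_left]
  obtain ⟨k, hk⟩ := exists_eq_add_smul_of_ldet_eq h.ldet_right hd
  have h1 : ldot e f = ldot e f' + k * ldot e e := by
    rw [← ldot_smul_right, ← ldot_add_right, ← hk]
  have a1 := h.ldot_left_pos
  have a2 := h'.ldot_left_pos
  have a3 := h.ldot_right_pos
  have a4 := h'.ldot_right_pos
  have b1 : ldot e e = ldot f e + ldot g e := by rw [← ldot_add_left, ← h.2.2]
  have b2 : ldot e e = ldot f' e + ldot g' e := by rw [← ldot_add_left, ← h'.2.2]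
  rw [ldot_comm e f, ldot_comm e f'] at h1
  have hk0 : k = 0 := by
    by_contra hne
    rcases lt_or_gt_of_ne hne with hl | hl
    · nlinarith
    · nlinarith
  have hf : f = f' := by rw [hk, hk0, zero_smul, add_zero]
  refine ⟨hf, ?_⟩
  have := h.2.2.symm.trans h'.2.2
  rw [hf] at this
  exact add_left_cancel this

/-- If `f` has parents `f₁, f₂`, an acute basis `(f, g)` has `g = f₂ + k f` with `k ≥ 0`. -/
theorem IsParentPair.right_eq {f g e f₁ f₂ : IntVec} (h : IsParentPair f g e)
    (hf : IsParentPair f₁ f₂ f) : ∃ k : ℕ, g = f₂ + k • f := by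
  obtain ⟨k, hk⟩ := exists_eq_add_smul_of_ldet_eq (a := g) (b := f₂) h.ldet_eq_one
    (h.ldet_eq_one.trans hf.ldet_right.symm)
  have h1 : ldot f g = ldot f f₂ + k * ldot f f := by
    rw [← ldot_smul_right, ← ldot_add_right, ← hk]
  have b1 : ldot f f = ldot f₁ f + ldot f₂ f := by rw [← ldot_add_left, ← hf.2.2]
  have := h.ldot_nonneg
  have := hf.ldot_left_pos
  rw [ldot_comm f f₂] at h1
  have hf0 := h.irreducible_left.ldot_self_pos
  have hk0 : 0 ≤ k := by
    by_contra hneg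
    push Not at hneg
    nlinarith
  lift k to ℕ using hk0
  exact ⟨k, by rw [hk, natCast_zsmul]⟩

/-- If `g` has parents `g₁, g₂`, an acute basis `(f, g)` has `f = g₁ + k g` with `k ≥ 0`. -/
theorem IsParentPair.left_eq {f g e g₁ g₂ : IntVec} (h : IsParentPair f g e)
    (hg : IsParentPair g₁ g₂ g) : ∃ k : ℕ, f = g₁ + k • g := by
  have hd : ldet g f = ldet g g₁ := by
    rw [ldet_swap g f, ldet_swap g g₁, h.ldet_eq_one, hg.ldet_left]
  obtain ⟨k, hk⟩ := exists_eq_add_smul_of_ldet_eq hg.ldet_right hd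
  have h1 : ldot g f = ldot g g₁ + k * ldot g g := by
    rw [← ldot_smul_right, ← ldot_add_right, ← hk]
  have b1 : ldot g g = ldot g₁ g + ldot g₂ g := by rw [← ldot_add_left, ← hg.2.2]
  have := h.ldot_nonneg
  have := hg.ldot_right_pos
  rw [ldot_comm g g₁, ldot_comm g f] at h1
  have hf0 := h.irreducible_right.ldot_self_pos
  have hk0 : 0 ≤ k := by
    by_contra hneg
    push Not at hneg
    nlinarith
  lift k to ℕ using hk0
  exact ⟨k, by rw [hk, natCast_zsmul]⟩

/-- Here `(x, y)` and `(z, w)` are the coordinates of `f` and `g` in an acute basis `(a, b)`, with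
`A = |a|²`, `B = |b|²`, `d = ⟨a, b⟩`. If `y < 0` then `w > 0`; for `x ≤ 0` the scalar product of `f`
and `g` is negative, and for `x > 0` integrality pushes the determinant above 1. -/
theorem nonneg_of_acute_coordinates {x y z w A B d : ℤ} (hA : 0 < A) (hB : 0 < B) (hd : 0 ≤ d)
    (hdet : x * w - y * z = 1) (hxz : 0 < x + z) (hyw : 0 < y + w)
    (hdot : 0 ≤ x * z * A + (x * w + y * z) * d + y * w * B) : 0 ≤ y := by
  by_contra! hy
  have hw : 0 < w := by linarith
  rcases lt_trichotomy x 0 with hx | hx | hx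
  · have hz : 0 < z := by linarith
    have h1 : x * z < 0 := mul_neg_of_neg_of_pos hx hz
    have h2 : y * w < 0 := mul_neg_of_neg_of_pos hy hw
    have h3 : x * w < 0 := mul_neg_of_neg_of_pos hx hw
    have h4 : y * z < 0 := mul_neg_of_neg_of_pos hy hz
    have h5 : (x * w + y * z) * d ≤ 0 := mul_nonpos_of_nonpos_of_nonneg (by linarith) hd
    have h6 : x * z * A < 0 := mul_neg_of_neg_of_pos h1 hA
    have h7 : y * w * B < 0 := mul_neg_of_neg_of_pos h2 hB
    linarith
  · subst hx
    have h2 : y * w * B < 0 := mul_neg_of_neg_of_pos (mul_neg_of_neg_of_pos hy hw) hB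
    have h3 : y * z = -1 := by linarith
    rw [zero_mul, zero_mul, zero_mul, h3] at hdot
    linarith
  · rcases le_or_gt z 0 with hz | hz
    · have h1 := mul_nonneg (by linarith : 0 ≤ x - (-z + 1)) hw.le
      have h2 := mul_nonneg (by linarith : 0 ≤ w - (-y + 1)) (by linarith : 0 ≤ -z + 1)
      linarith
    · have h1 := mul_pos hx hw
      have h2 := mul_pos (neg_pos.2 hy) hz
      linarith

/-- The parents of a vector in the interior of the cone of an acute basis lie in the closed
cone. -/
theorem IsParentPair.mem_cone_of_acute_basis {a b e f g : IntVec} (hab : ldet a b = 1)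
    (hdot : 0 ≤ ldot a b) (h : IsParentPair f g e) (hae : 0 < ldet a e) (heb : 0 < ldet e b) :
    0 ≤ ldet a f ∧ 0 < ldet a g ∧ 0 ≤ ldet g b ∧ 0 < ldet f b := by
  have cf := ldet_smul_eq a b f
  have cg := ldet_smul_eq a b g
  rw [hab, one_smul] at cf cg
  have hfg := h.ldet_eq_one
  have hfg' := h.ldot_nonneg
  have e1 : ldet f b + ldet g b = ldet e b := by rw [← ldet_add_left, ← h.2.2]
  have e2 : ldet a f + ldet a g = ldet a e := by rw [← ldet_add_right, ← h.2.2]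
  have hA := (irreducibleVec_of_ldet_eq_one hab).ldot_self_pos
  have hB := (irreducibleVec_of_ldet_eq_one' hab).ldot_self_pos
  generalize hx : ldet f b = x at *
  generalize hy : ldet a f = y at *
  generalize hz : ldet g b = z at *
  generalize hw : ldet a g = w at *
  have hdet : x * w - y * z = 1 := by
    have := ldet_mul_ldet a b f g
    rw [hab, hfg, ldet_swap b g, hx, hy, hz, hw] at this
    linarith
  have hdt : ldot f g = x * z * ldot a a + (x * w + y * z) * ldot a b + y * w * ldot b b := by
    rw [cf, cg]; simp only [ldot, Prod.fst_add, Prod.snd_add, Prod.smul_fst, Prod.smul_snd,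
      smul_eq_mul]; ring
  rw [hdt] at hfg'
  have hy0 : 0 ≤ y := nonneg_of_acute_coordinates hA hB hdot hdet (by omega) (by omega) hfg'
  have hz0 : 0 ≤ z := nonneg_of_acute_coordinates (x := w) (y := z) (z := y) (w := x) hB hA hdot
    (by linarith) (by omega) (by omega) (by linarith)
  have hyz := mul_nonneg hy0 hz0
  refine ⟨hy0, ?_, hz0, ?_⟩
  · by_contra! hc
    nlinarith [mul_nonneg hy0 hz0, mul_nonneg hz0 (neg_nonneg.2 hc)]
  · by_contra! hc
    nlinarith [mul_nonneg hy0 (neg_nonneg.2 hc)]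

/-! ### Stable sets of lattice vectors. -/

/-- A set of lattice vectors stable under those sub-convex combinations of two elements which are
lattice vectors. -/
def LatticeConvex (S : Set IntVec) : Prop :=
  ∀ (a b e : IntVec) (i j n : ℤ), 0 ≤ i → 0 ≤ j → i + j ≤ n → 0 < n → a ∈ S → b ∈ S →
    n • e = i • a + j • b → e ∈ S

/-- A set of lattice vectors containing those parents of its elements which lie in `S`. -/
def StableIn (S V : Set IntVec) : Prop :=
  ∀ e ∈ V, ∀ f g, IsParentPair f g e → (f ∈ S → f ∈ V) ∧ (g ∈ S → g ∈ V)

/-- Exchanging the coordinates reverses orientation and exchanges the two parents, so each statement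
about first parents yields one about second parents. -/
theorem ldet_prodSwap (a b : IntVec) : ldet a.swap b.swap = ldet b a := by
  simp only [ldet, Prod.fst_swap, Prod.snd_swap]; ring

theorem ldot_prodSwap (a b : IntVec) : ldot a.swap b.swap = ldot a b := by
  simp only [ldot, Prod.fst_swap, Prod.snd_swap]; ring

theorem IrreducibleVec.prodSwap {e : IntVec} (h : IrreducibleVec e) : IrreducibleVec e.swap := by
  rw [IrreducibleVec, Prod.fst_swap, Prod.snd_swap, Int.gcd_comm]; exact h

theorem IsParentPair.prodSwap {f g e : IntVec} (h : IsParentPair f g e) :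
    IsParentPair g.swap f.swap e.swap := by
  refine ⟨?_, ?_, ?_⟩
  · have := ldet_prodSwap g f
    rw [h.ldet_eq_one] at this
    exact this
  · have := ldot_prodSwap g f
    rw [ldot_comm g f] at this
    change 0 ≤ ldot g.swap f.swap
    rw [this]; exact h.ldot_nonneg
  · rw [h.2.2, Prod.swap_add, add_comm]

theorem LatticeConvex.prodSwap {S : Set IntVec} (hS : LatticeConvex S) :
    LatticeConvex (Prod.swap ⁻¹' S) := by
  intro a b e i j n hi hj hij hn ha hb h
  refine hS a.swap b.swap e.swap i j n hi hj hij hn ha hb ?_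
  have h1 := congrArg Prod.fst h
  have h2 := congrArg Prod.snd h
  simp only [Prod.smul_fst, Prod.smul_snd, Prod.fst_add, Prod.snd_add] at h1 h2
  ext
  · simpa only [Prod.smul_fst, Prod.fst_add, Prod.fst_swap] using h2
  · simpa only [Prod.smul_snd, Prod.snd_add, Prod.snd_swap] using h1

theorem StableIn.prodSwap {S V : Set IntVec} (h : StableIn S V) :
    StableIn (Prod.swap ⁻¹' S) (Prod.swap ⁻¹' V) := by
  intro e he f g hp
  exact ⟨(h _ he _ _ hp.prodSwap).2, (h _ he _ _ hp.prodSwap).1⟩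

theorem eq_of_ldet_eq_zero {e g : IntVec} (he : IrreducibleVec e) (hg : IrreducibleVec g)
    (h : ldet e g = 0) (hd : 0 < ldot e g) : e = g := by
  have h1 : ldot e e • g = ldot e g • e := by
    ext <;> simp only [ldot, ldet, Prod.smul_fst, Prod.smul_snd, smul_eq_mul] at h ⊢
    · linear_combination (-e.2) * h
    · linear_combination e.1 * h
  have h2 : ldot g g • e = ldot e g • g := by
    ext <;> simp only [ldot, ldet, Prod.smul_fst, Prod.smul_snd, smul_eq_mul] at h ⊢
    · linear_combination g.2 * h
    · linear_combination (-g.1) * h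
  obtain ⟨a, b, hab⟩ : IsCoprime e.1 e.2 := Int.isCoprime_iff_gcd_eq_one.2 he
  obtain ⟨c, d, hcd⟩ : IsCoprime g.1 g.2 := Int.isCoprime_iff_gcd_eq_one.2 hg
  have k1 : ldot e e ∣ ldot e g := by
    refine ⟨a * g.1 + b * g.2, ?_⟩
    have x1 := congrArg Prod.fst h1
    have x2 := congrArg Prod.snd h1
    simp only [Prod.smul_fst, Prod.smul_snd, smul_eq_mul] at x1 x2
    linear_combination (-a) * x1 - b * x2 - ldot e g * hab
  have k2 : ldot e g ∣ ldot e e := by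
    refine ⟨c * e.1 + d * e.2, ?_⟩
    have x1 := congrArg Prod.fst h1
    have x2 := congrArg Prod.snd h1
    simp only [Prod.smul_fst, Prod.smul_snd, smul_eq_mul] at x1 x2
    linear_combination c * x1 + d * x2 - ldot e e * hcd
  have k3 : ldot e e = ldot e g :=
    Int.dvd_antisymm he.ldot_self_pos.le hd.le k1 k2
  rw [k3] at h1
  ext
  · have x1 := congrArg Prod.fst h1
    exact (mul_left_cancel₀ hd.ne' x1).symm
  · have x1 := congrArg Prod.snd h1
    exact (mul_left_cancel₀ hd.ne' x1).symm

/-- Descent on the norm of `v`, with `e` counterclockwise from `v` at an acute angle. If `v` is not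
a unit vector, its second parent `g` makes `(v, g)` an acute basis. Either `e` lies inside its cone,
or `e = g`, or `g` lies between `v` and `e`. In the last case lattice convexity puts `g` in `S`,
stability puts it in `V`, and the descent continues from the shorter vector `g`. The clause on `c`
records that `a` stays between `v` and `e`. -/
theorem exists_acute_basis_around {S V : Set IntVec} (hS : LatticeConvex S)
    (hVi : ∀ v ∈ V, IrreducibleVec v) (hVS : V ⊆ S) (hV : StableIn S V) {e : IntVec}
    (he : IrreducibleVec e) (heS : e ∈ S) (n : ℕ) :
    ∀ v ∈ V, (ldot v v).toNat ≤ n → 0 < ldot v e → 0 < ldet v e →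
      e ∈ V ∨ ∃ a ∈ V, ∃ b, ldet a b = 1 ∧ 0 ≤ ldot a b ∧ 0 < ldet a e ∧ 0 < ldet e b ∧
        ∀ c, 0 < ldet v c → 0 < ldet e c → 0 < ldet a c := by
  induction n with
  | zero =>
    intro v hv hn
    have := (hVi v hv).ldot_self_pos
    omega
  | succ n ih =>
    intro v hv hn hdot hdet
    have hvp := (hVi v hv).ldot_self_pos
    rcases eq_or_lt_of_le (show 1 ≤ ldot v v by omega) with h1 | h1
    · right
      -- A unit vector and its quarter turn form an orthonormal basis.
      refine ⟨v, hv, (-v.2, v.1), ?_, ?_, hdet, ?_, fun c hc _ => hc⟩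
      · rw [h1]; simp only [ldet, ldot]; ring
      · simp only [ldot]; exact le_of_eq (by ring)
      · have : ldet e (-v.2, v.1) = ldot v e := by simp only [ldet, ldot]; ring
        rw [this]; exact hdot
    · obtain ⟨f, g, hp⟩ := exists_isParentPair (hVi v hv) h1
      have hvg : ldet v g = 1 := hp.ldet_right
      have hvg0 : 0 < ldot v g := ldot_comm g v ▸ hp.ldot_right_pos
      rcases lt_trichotomy (ldet e g) 0 with h2 | h2 | h2
      · have hge : 0 < ldet g e := by rw [ldet_swap]; omega
        have hcr := ldet_smul_eq f g e
        rw [hp.ldet_eq_one, one_smul] at hcr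
        have hve : ldet v e = ldet f e + ldet g e := by rw [hp.2.2, ldet_add_left]
        have hff := hp.irreducible_left.ldot_self_pos
        have hgg := hp.irreducible_right.ldot_self_pos
        have hfg := hp.ldot_nonneg
        have hlag := ldot_sq_add_ldet_sq f g
        rw [hp.ldet_eq_one] at hlag
        have hev : ldot v e = ldet e g * (ldot f f + ldot f g)
            + ldet f e * (ldot f g + ldot g g) := by
          conv_lhs => rw [hcr, hp.2.2]
          simp only [ldot_add_left, ldot_add_right, ldot_smul_right, ldot_comm g f]
        have heg : ldot g e = ldet e g * ldot f g + ldet f e * ldot g g := by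
          conv_lhs => rw [hcr]
          simp only [ldot_add_right, ldot_smul_right, ldot_comm g f]
        have hfe : 1 ≤ ldet f e := by
          by_contra! hc
          have t1 : ldet e g * (ldot f f + ldot f g) < 0 :=
            mul_neg_of_neg_of_pos h2 (by omega)
          have t2 : ldet f e * (ldot f g + ldot g g) ≤ 0 :=
            mul_nonpos_of_nonpos_of_nonneg (by omega) (by omega)
          omega
        -- Otherwise `⟨f, e⟩ > 0`, since `v = f + g`; combining the two inequalities eliminates the
        -- coefficient of `f` in `e` and leaves `ldet f e * ldet f g ^ 2 ≤ 0`.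
        have hge0 : 0 < ldot g e := by
          by_contra! hc
          rw [heg] at hc
          have s1 : 0 < ldet e g * ldot f f + ldet f e * ldot f g := by linarith
          have s2 : 0 ≤ ldot f g * (ldet e g * ldot f f + ldet f e * ldot f g) :=
            mul_nonneg hfg s1.le
          have s3 : ldot f f * (ldet e g * ldot f g + ldet f e * ldot g g) ≤ 0 :=
            mul_nonpos_of_nonneg_of_nonpos hff.le hc
          have s4 : ldet f e * (ldot f f * ldot g g - ldot f g ^ 2) ≤ 0 := by linarith
          rw [← hlag] at s4
          linarith
        have hgS : g ∈ S := by
          refine hS v e g (ldet g e) 1 (ldet v e) hge.le (by norm_num) (by omega) hdet (hVS hv)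
            heS ?_
          rw [ldet_smul_eq v e g, hvg]
        have hgV : g ∈ V := (hV v hv f g hp).2 hgS
        have hlt := hp.ldot_self_right_lt
        rcases ih g hgV (by omega) hge0 hge with h | ⟨a, ha, b, hab, h3, h4, h5, h6⟩
        · exact Or.inl h
        · refine Or.inr ⟨a, ha, b, hab, h3, h4, h5, fun c hvc hec => h6 c ?_ hec⟩
          have := ldet_mul_ldet v e g c
          rw [hvg] at this
          have : 0 < ldet v e * ldet g c := by
            rw [this]
            have := mul_pos hge hvc
            linarith
          exact pos_of_mul_pos_right this hdet.le
      · left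
        have hcr := ldet_smul_eq v g e
        rw [hvg, h2, one_smul, zero_smul, zero_add] at hcr
        have : 0 < ldot e g := by
          have h3 := ldot_smul_right (ldet v e) g g
          rw [← hcr, ldot_comm] at h3
          rw [h3]
          exact mul_pos hdet hp.irreducible_right.ldot_self_pos
        have heq := eq_of_ldet_eq_zero he hp.irreducible_right h2 this
        rw [heq]
        exact (hV v hv f g hp).2 (heq ▸ heS)
      · exact Or.inr ⟨v, hv, g, hvg, hvg0.le, hdet, h2, fun c hc _ => hc⟩

/-- The parents of `e` lie in the cone of the acute basis `(a, b)` found around `e`. So `f` lies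
between `a` and `e`, and Cramer's rule writes it as a sub-convex combination of these two elements
of `S`. -/
theorem exists_left_parent_mem {S V : Set IntVec} (hS : LatticeConvex S)
    (hVi : ∀ v ∈ V, IrreducibleVec v) (hVS : V ⊆ S) (hV : StableIn S V) {e v : IntVec}
    (he : IrreducibleVec e) (heS : e ∈ S) (hv : v ∈ V) (hdot : 0 < ldot v e)
    (hdet : 0 < ldet v e) :
    e ∈ V ∨ ∃ f g, IsParentPair f g e ∧ f ∈ S ∧
      ∀ c, 0 < ldet v c → 0 < ldet e c → 0 < ldet f c := by
  rcases exists_acute_basis_around hS hVi hVS hV he heS _ v hv le_rfl hdot hdet with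
    h | ⟨a, ha, b, hab, h3, h4, h5, h6⟩
  · exact Or.inl h
  right
  -- As `e` has positive coordinates in an acute basis, its squared norm is at least `|a|² + |b|²`.
  have hnu : 1 < ldot e e := by
    have hcr := ldet_smul_eq a b e
    rw [hab, one_smul] at hcr
    have hee : ldot e e = ldet e b ^ 2 * ldot a a + ldet a e ^ 2 * ldot b b
        + 2 * (ldet e b * ldet a e) * ldot a b := by
      conv_lhs => rw [hcr]
      simp only [ldot, Prod.fst_add, Prod.snd_add, Prod.smul_fst, Prod.smul_snd, smul_eq_mul]
      ring
    have hA := (irreducibleVec_of_ldet_eq_one hab).ldot_self_pos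
    have hB := (irreducibleVec_of_ldet_eq_one' hab).ldot_self_pos
    have t1 := mul_pos (pow_pos h5 2) hA
    have t2 := mul_pos (pow_pos h4 2) hB
    have t3 := mul_nonneg (mul_pos h5 h4).le h3
    linarith
  obtain ⟨f, g, hp⟩ := exists_isParentPair he hnu
  obtain ⟨c1, c2, -, -⟩ := hp.mem_cone_of_acute_basis hab h3 h4 h5
  have hsum : ldet a e = ldet a f + ldet a g := by rw [← ldet_add_right, ← hp.2.2]
  refine ⟨f, g, hp, ?_, fun c hvc hec => ?_⟩
  · refine hS a e f 1 (ldet a f) (ldet a e) (by norm_num) c1 (by omega) h4 (hVS ha) heS ?_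
    rw [ldet_smul_eq a e f, hp.ldet_left]
  · have hac := h6 c hvc hec
    have := ldet_mul_ldet a e f c
    rw [hp.ldet_left] at this
    have : 0 < ldet a e * ldet f c := by
      rw [this]
      have := mul_nonneg c1 hec.le
      linarith
    exact pos_of_mul_pos_right this h4.le

theorem exists_right_parent_mem {S V : Set IntVec} (hS : LatticeConvex S)
    (hVi : ∀ v ∈ V, IrreducibleVec v) (hVS : V ⊆ S) (hV : StableIn S V) {e v : IntVec}
    (he : IrreducibleVec e) (heS : e ∈ S) (hv : v ∈ V) (hdot : 0 < ldot e v)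
    (hdet : 0 < ldet e v) :
    e ∈ V ∨ ∃ f g, IsParentPair f g e ∧ g ∈ S := by
  rcases exists_left_parent_mem hS.prodSwap (V := Prod.swap ⁻¹' V) (e := e.swap) (v := v.swap)
    (fun w hw => by simpa using (hVi _ hw).prodSwap) (fun w hw => hVS hw) hV.prodSwap he.prodSwap
    (by simpa using heS) (by simpa using hv) (by rw [ldot_prodSwap, ldot_comm]; exact hdot)
    (by rw [ldet_prodSwap]; exact hdet) with h | ⟨f, g, hp, hf, -⟩
  · exact Or.inl (by simpa using h)
  · exact Or.inr ⟨g.swap, f.swap, by simpa using hp.prodSwap, hf⟩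

theorem parents_mem_of_acute {S V : Set IntVec} (hS : LatticeConvex S)
    (hVi : ∀ v ∈ V, IrreducibleVec v) (hVS : V ⊆ S) (hV : StableIn S V) {e v w : IntVec}
    (he : IrreducibleVec e) (heS : e ∈ S) (hv : v ∈ V) (hw : w ∈ V) (hdot : 0 < ldot v e)
    (hve : 0 < ldet v e) (hew : 0 < ldet e w) (hvw : 0 < ldet v w) :
    e ∈ V ∨ ∃ f g, IsParentPair f g e ∧ f ∈ S ∧ g ∈ S := by
  rcases exists_left_parent_mem hS hVi hVS hV he heS hv hdot hve with h | ⟨f, g, hp, hf, hc⟩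
  · exact Or.inl h
  rcases lt_or_ge 0 (ldot e w) with h1 | h1
  · rcases exists_right_parent_mem hS hVi hVS hV he heS hw h1 hew with h | ⟨f', g', hp', hg⟩
    · exact Or.inl h
    · obtain ⟨-, rfl⟩ := hp.unique hp'
      exact Or.inr ⟨f, g, hp, hf, hg⟩
  -- The angle from `e` to `w` is at least a right angle, hence `g` lies between them. Since `ldet f
  -- w ≥ 1`, Cramer's rule gives coefficients of sum at most `ldet e w`, and `g ∈ S` by convexity.
  · refine Or.inr ⟨f, g, hp, hf, ?_⟩
    have hfw := hc w hvw hew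
    have hgw : 0 ≤ ldet g w := by
      have hid := ldot_self_mul_ldet e g w
      rw [hp.ldet_right, ldot_comm e g] at hid
      have t1 := mul_pos hp.ldot_right_pos hew
      have : 0 < ldot e e * ldet g w := by linarith
      exact (pos_of_mul_pos_right this he.ldot_self_pos.le).le
    have hsum : ldet e w = ldet f w + ldet g w := by rw [← ldet_add_left, ← hp.2.2]
    refine hS e w g (ldet g w) 1 (ldet e w) hgw (by norm_num) (by omega) hew heS (hVS hw) ?_
    rw [ldet_smul_eq e w g, hp.ldet_right]

/-- If a stable set `V` has elements on both sides of `e`, at an angle less than `π`, then it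
contains `e` or both parents of `e` are available. -/
theorem mem_or_parents_mem {S V : Set IntVec} (hS : LatticeConvex S)
    (hVi : ∀ v ∈ V, IrreducibleVec v) (hVS : V ⊆ S) (hV : StableIn S V) {e v w : IntVec}
    (he : IrreducibleVec e) (heS : e ∈ S) (hv : v ∈ V) (hw : w ∈ V)
    (hve : 0 < ldet v e) (hew : 0 < ldet e w) (hvw : 0 < ldet v w) :
    e ∈ V ∨ ∃ f g, IsParentPair f g e ∧ f ∈ S ∧ g ∈ S := by
  rcases lt_or_ge 0 (ldot v e) with h1 | h1
  · exact parents_mem_of_acute hS hVi hVS hV he heS hv hw h1 hve hew hvw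
  rcases lt_or_ge 0 (ldot e w) with h2 | h2
  · rcases parents_mem_of_acute hS.prodSwap (V := Prod.swap ⁻¹' V) (e := e.swap) (v := w.swap)
      (w := v.swap)
      (fun w hw => by simpa using (hVi _ hw).prodSwap) (fun w hw => hVS hw) hV.prodSwap
      he.prodSwap (by simpa using heS) (by simpa using hw) (by simpa using hv)
      (by rw [ldot_prodSwap, ldot_comm]; exact h2) (by rw [ldet_prodSwap]; exact hew)
      (by rw [ldet_prodSwap]; exact hve) (by rw [ldet_prodSwap]; exact hvw) with
      h | ⟨f, g, hp, hf, hg⟩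
    · exact Or.inl (by simpa using h)
    · exact Or.inr ⟨g.swap, f.swap, by simpa using hp.prodSwap, hg, hf⟩
  · exfalso
    -- Two angles of at least `π/2` would add up to at least `π`, against `0 < ldet v w`.
    have hid := ldot_self_mul_ldet e v w
    rw [ldot_comm e v, ldet_swap e v] at hid
    have t1 := mul_nonneg (neg_nonneg.2 h1) hew.le
    have t2 := mul_nonneg (neg_nonneg.2 h2) hve.le
    have t3 := mul_pos he.ldot_self_pos hvw
    linarith

/-! ### Convex functions on the rotated grid. -/

theorem latticeVec_add (a b : IntVec) : latticeVec (a + b) = latticeVec a + latticeVec b := by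
  ext i; fin_cases i <;> simp [latticeVec]

theorem latticeVec_smul (n : ℤ) (a : IntVec) : latticeVec (n • a) = (n : ℝ) • latticeVec a := by
  ext i; fin_cases i <;> simp [latticeVec]

theorem latticeVec_zero : latticeVec 0 = 0 := by
  ext i; fin_cases i <;> simp [latticeVec]

theorem latticeVec_neg (a : IntVec) : latticeVec (-a) = -latticeVec a := by
  ext i; fin_cases i <;> simp [latticeVec]

theorem latticeVec_injective : Function.Injective latticeVec := by
  intro a b h
  have h0 := congrArg (fun v : Plane => v 0) h
  have h1 := congrArg (fun v : Plane => v 1) h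
  simp [latticeVec] at h0 h1
  exact Prod.ext h0 h1

theorem rotate_add (θ : ℝ) (v w : Plane) : rotate θ (v + w) = rotate θ v + rotate θ w := by
  ext i; fin_cases i <;> simp [rotate] <;> ring

theorem rotate_smul (θ c : ℝ) (v : Plane) : rotate θ (c • v) = c • rotate θ v := by
  ext i; fin_cases i <;> simp [rotate] <;> ring

theorem rotate_zero_vec (θ : ℝ) : rotate θ 0 = 0 := by
  ext i; fin_cases i <;> simp [rotate]

theorem rotate_neg_vec (θ : ℝ) (v : Plane) : rotate θ (-v) = -rotate θ v := by
  ext i; fin_cases i <;> simp [rotate] <;> ring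

theorem shift_zero (h θ : ℝ) (x : Plane) : shift h θ x 0 = x := by
  simp [shift, latticeVec_zero, rotate_zero_vec]

theorem shift_mem_gridPoints {Ω : Set Plane} {h θ : ℝ} {ξ x : Plane}
    (hx : x ∈ gridPoints Ω h θ ξ) {e : IntVec} (he : shift h θ x e ∈ Ω) :
    shift h θ x e ∈ gridPoints Ω h θ ξ := by
  obtain ⟨-, k, rfl⟩ := hx
  exact ⟨he, k + e, by
    simp only [shift, latticeVec_add, rotate_add, smul_add, add_assoc]⟩

theorem mem_maxStencils {Ω : Set Plane} {h θ : ℝ} {ξ x : Plane} {e : IntVec}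
    (hx : x ∈ gridPoints Ω h θ ξ) :
    (x, e) ∈ maxStencils Ω h θ ξ ↔ IrreducibleVec e ∧ shift h θ x e ∈ Ω :=
  ⟨fun H => ⟨H.2.1, H.2.2.1⟩, fun H => ⟨hx, H.1, shift_mem_gridPoints hx H.2⟩⟩

/-- The offsets leading from `x` to a point of `Ω`. -/
def availableOffsets (Ω : Set Plane) (h θ : ℝ) (x : Plane) : Set IntVec :=
  {e | shift h θ x e ∈ Ω}

theorem latticeConvex_availableOffsets {Ω : Set Plane} (hΩ : Convex ℝ Ω) (h θ : ℝ) {x : Plane}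
    (hx : x ∈ Ω) : LatticeConvex (availableOffsets Ω h θ x) := by
  intro a b e i j n hi hj hij hn ha hb hcomb
  have hn' : (0 : ℝ) < n := by exact_mod_cast hn
  have hi' : (0 : ℝ) ≤ i := by exact_mod_cast hi
  have hj' : (0 : ℝ) ≤ j := by exact_mod_cast hj
  have hij' : (i : ℝ) + j ≤ n := by exact_mod_cast hij
  have hv : (n : ℝ) • latticeVec e = (i : ℝ) • latticeVec a + (j : ℝ) • latticeVec b := by
    rw [← latticeVec_smul, hcomb, latticeVec_add, latticeVec_smul, latticeVec_smul]
  have hv' : latticeVec e = ((i : ℝ) / n) • latticeVec a + ((j : ℝ) / n) • latticeVec b := by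
    rw [div_eq_inv_mul, div_eq_inv_mul, mul_smul, mul_smul, ← smul_add, ← hv, smul_smul,
      inv_mul_cancel₀ hn'.ne', one_smul]
  have key := hΩ.sum_mem (t := Finset.univ)
    (w := ![1 - (i : ℝ) / n - j / n, (i : ℝ) / n, (j : ℝ) / n])
    (z := ![x, shift h θ x a, shift h θ x b]) (by
      intro k _
      fin_cases k
      · simp only [Fin.zero_eta, Matrix.cons_val_zero]
        have : (i : ℝ) / n + j / n ≤ 1 := by rw [← add_div]; exact (div_le_one hn').2 hij'
        linarith
      · simp only [Fin.mk_one, Matrix.cons_val_one, Matrix.cons_val_zero]; positivity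
      · simp; positivity) (by simp [Fin.sum_univ_three]; ring) (by
      intro k _
      fin_cases k
      · exact hx
      · exact ha
      · exact hb)
  have heq : shift h θ x e = ∑ k : Fin 3, (![1 - (i : ℝ) / n - j / n, (i : ℝ) / n, (j : ℝ) / n] k) •
      (![x, shift h θ x a, shift h θ x b] k) := by
    simp only [Fin.sum_univ_three, Matrix.cons_val_zero, Matrix.cons_val_one, Matrix.cons_val]
    simp only [shift, hv', rotate_add, rotate_smul]
    module
  change shift h θ x e ∈ Ω
  rw [heq]; exact key

theorem two_mul_le_of_convexOn {Ω : Set Plane} {U : Plane → ℝ} (hU : ConvexOn ℝ Ω U) {h θ : ℝ}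
    {x : Plane} {v w m : IntVec} (hv : shift h θ x v ∈ Ω) (hw : shift h θ x w ∈ Ω)
    (hm : v + w = m + m) :
    2 * U (shift h θ x m) ≤ U (shift h θ x v) + U (shift h θ x w) := by
  have key := hU.2 hv hw (show (0 : ℝ) ≤ 1 / 2 by norm_num) (show (0 : ℝ) ≤ 1 / 2 by norm_num)
    (by norm_num)
  have heq : (1 / 2 : ℝ) • shift h θ x v + (1 / 2 : ℝ) • shift h θ x w = shift h θ x m := by
    have h1 : latticeVec v = latticeVec m + latticeVec m - latticeVec w := by
      rw [← latticeVec_add, ← hm, latticeVec_add, add_sub_cancel_right]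
    simp only [shift, h1, sub_eq_add_neg, rotate_add, rotate_neg_vec]
    module
  rw [heq] at key
  simp only [smul_eq_mul] at key
  linarith

theorem segmentForm_nonneg {Ω : Set Plane} {U : Plane → ℝ} (hU : ConvexOn ℝ Ω U) {h θ : ℝ}
    {x : Plane} {e : IntVec} (h1 : shift h θ x e ∈ Ω)
    (h2 : shift h θ x (-e) ∈ Ω) : 0 ≤ segmentForm h θ x e U := by
  have := two_mul_le_of_convexOn hU (m := 0) h1 h2 (by simp)
  rw [shift_zero] at this
  rw [segmentForm]; linarith

theorem triangleForm_nonneg {Ω : Set Plane} {U : Plane → ℝ} (hU : ConvexOn ℝ Ω U) {h θ : ℝ}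
    {x : Plane} {e f g : IntVec} (hp : IsParentPair f g e) (h1 : shift h θ x e ∈ Ω)
    (h2 : shift h θ x (-f) ∈ Ω) (h3 : shift h θ x (-g) ∈ Ω) :
    0 ≤ triangleForm h θ x e f g U := by
  have hm := hU.1 h2 h3 (show (0 : ℝ) ≤ 1 / 2 by norm_num) (show (0 : ℝ) ≤ 1 / 2 by norm_num)
    (by norm_num)
  have k1 := hU.2 h2 h3 (show (0 : ℝ) ≤ 1 / 2 by norm_num) (show (0 : ℝ) ≤ 1 / 2 by norm_num)
    (by norm_num)
  have k2 := hU.2 h1 hm (show (0 : ℝ) ≤ 1 / 3 by norm_num) (show (0 : ℝ) ≤ 2 / 3 by norm_num)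
    (by norm_num)
  have heq : (1 / 3 : ℝ) • shift h θ x e + (2 / 3 : ℝ) • ((1 / 2 : ℝ) • shift h θ x (-f) +
      (1 / 2 : ℝ) • shift h θ x (-g)) = x := by
    simp only [shift, hp.2.2, latticeVec_add, latticeVec_neg, rotate_add, rotate_neg_vec]
    module
  rw [heq] at k2
  simp only [smul_eq_mul] at k1 k2
  rw [triangleForm]; linarith

/-- The increments of a convex function along an arithmetic progression are nondecreasing. Only the
end points need be assumed in `Ω`: the points between them follow by convexity. -/
theorem sub_le_sub_of_convexOn {Ω : Set Plane} {U : Plane → ℝ} (hU : ConvexOn ℝ Ω U) {h θ : ℝ}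
    {x : Plane} (hx : x ∈ Ω) {v w : IntVec} (hv : shift h θ x v ∈ Ω) (k : ℕ)
    (hw : shift h θ x (v + (k + 1) • w) ∈ Ω) :
    U (shift h θ x (v + w)) - U (shift h θ x v) ≤
      U (shift h θ x (v + (k + 1) • w)) - U (shift h θ x (v + k • w)) := by
  have hL := latticeConvex_availableOffsets hU.1 h θ hx
  induction k with
  | zero => simp
  | succ k ih =>
    have hmid : shift h θ x (v + (k + 1) • w) ∈ Ω := by
      refine hL v (v + (k + 1 + 1) • w) _ 1 (k + 1) (k + 2) (by norm_num) (by positivity)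
        (by omega) (by positivity) hv hw ?_
      simp only [← natCast_zsmul]
      push_cast
      module
    have hlow : shift h θ x (v + k • w) ∈ Ω := by
      refine hL v (v + (k + 1 + 1) • w) _ 2 k (k + 2) (by norm_num) (by positivity)
        (by omega) (by positivity) hv hw ?_
      simp only [← natCast_zsmul]
      push_cast
      module
    have h1 := ih hmid
    have h2 := two_mul_le_of_convexOn hU (m := v + (k + 1) • w) hlow hw (by module)
    linarith

/-- Write `u(v)` for the value of `U` at the shift of `x` by `v`. With `g = f₂ + k f`, the
increments along `f₂ + ℕ f` give `u(f₂ + f) - u(f₂) ≤ u(e) - u(g) < u(f) - u(0)`. Since `f` is the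
midpoint of `f₁` and `f₂ + f`, also `2 u(f) ≤ u(f₁) + u(f₂ + f)`; adding up yields the claim. The
vector `g` is available because it lies between `f₂` and `e`. -/
theorem parallelogramForm_left_neg {Ω : Set Plane} {U : Plane → ℝ} (hU : ConvexOn ℝ Ω U)
    {h θ : ℝ} {x : Plane} (hx : x ∈ Ω) {e f g f₁ f₂ : IntVec} (hp : IsParentPair f g e)
    (he : shift h θ x e ∈ Ω)
    (hneg : shift h θ x g ∈ Ω → parallelogramForm h θ x e f g U < 0)
    (hpf : IsParentPair f₁ f₂ f) (h1 : shift h θ x f₁ ∈ Ω) (h2 : shift h θ x f₂ ∈ Ω) :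
    parallelogramForm h θ x f f₁ f₂ U < 0 := by
  have hL := latticeConvex_availableOffsets hU.1 h θ hx
  obtain ⟨k, hk⟩ := hp.right_eq hpf
  have hek : e = f₂ + (k + 1) • f := by rw [hp.2.2, hk]; module
  have hg : shift h θ x g ∈ Ω := by
    refine hL f₂ e g 1 k (k + 1) (by norm_num) (by positivity) (by omega) (by positivity) h2 he ?_
    rw [hek, hk]; simp only [← natCast_zsmul]
    push_cast
    module
  have hf : shift h θ x (f₂ + f) ∈ Ω := by
    refine hL f₂ e _ k 1 (k + 1) (by positivity) (by norm_num) (by omega) (by positivity) h2 he ?_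
    rw [hek]; simp only [← natCast_zsmul]
    push_cast
    module
  have k1 := sub_le_sub_of_convexOn hU hx h2 k (hek ▸ he)
  rw [← hek, ← hk] at k1
  have k2 := two_mul_le_of_convexOn hU (m := f) h1 hf (by nth_rw 2 [hpf.2.2]; rw [hpf.2.2]; module)
  have k3 := hneg hg
  rw [parallelogramForm] at k3 ⊢
  linarith

theorem parallelogramForm_right_neg {Ω : Set Plane} {U : Plane → ℝ} (hU : ConvexOn ℝ Ω U)
    {h θ : ℝ} {x : Plane} (hx : x ∈ Ω) {e f g g₁ g₂ : IntVec} (hp : IsParentPair f g e)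
    (he : shift h θ x e ∈ Ω)
    (hneg : shift h θ x f ∈ Ω → parallelogramForm h θ x e f g U < 0)
    (hpg : IsParentPair g₁ g₂ g) (h1 : shift h θ x g₁ ∈ Ω) (h2 : shift h θ x g₂ ∈ Ω) :
    parallelogramForm h θ x g g₁ g₂ U < 0 := by
  have hL := latticeConvex_availableOffsets hU.1 h θ hx
  obtain ⟨k, hk⟩ := hp.left_eq hpg
  have hek : e = g₁ + (k + 1) • g := by rw [hp.2.2, hk]; module
  have hf : shift h θ x f ∈ Ω := by
    refine hL g₁ e f 1 k (k + 1) (by norm_num) (by positivity) (by omega) (by positivity) h1 he ?_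
    rw [hek, hk]; simp only [← natCast_zsmul]
    push_cast
    module
  have hg : shift h θ x (g₁ + g) ∈ Ω := by
    refine hL g₁ e _ k 1 (k + 1) (by positivity) (by norm_num) (by omega) (by positivity) h1 he ?_
    rw [hek]; simp only [← natCast_zsmul]
    push_cast
    module
  have k1 := sub_le_sub_of_convexOn hU hx h1 k (hek ▸ he)
  rw [← hek, ← hk] at k1
  have k2 := two_mul_le_of_convexOn hU (m := g) h2 hg (by nth_rw 2 [hpg.2.2]; rw [hpg.2.2]; module)
  have k3 := hneg hf
  rw [parallelogramForm] at k3 ⊢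
  linarith

/-! ### Cones generated by lattice vectors. -/

/-- The determinant of two plane vectors. -/
def planeDet (v w : Plane) : ℝ := v 0 * w 1 - v 1 * w 0

theorem planeDet_add_left (u v w : Plane) :
    planeDet (u + v) w = planeDet u w + planeDet v w := by
  simp [planeDet]; ring

theorem planeDet_add_right (u v w : Plane) :
    planeDet w (u + v) = planeDet w u + planeDet w v := by
  simp [planeDet]; ring

theorem planeDet_smul_left (c : ℝ) (v w : Plane) : planeDet (c • v) w = c * planeDet v w := by
  simp [planeDet]; ring

theorem planeDet_smul_right (c : ℝ) (v w : Plane) : planeDet w (c • v) = c * planeDet w v := by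
  simp [planeDet]; ring

theorem planeDet_self (v : Plane) : planeDet v v = 0 := by
  simp [planeDet]; ring

theorem planeDet_latticeVec (a b : IntVec) :
    planeDet (latticeVec a) (latticeVec b) = (ldet a b : ℝ) := by
  simp [planeDet, latticeVec, ldet]

/-- The strict alternative, and not just `0 ≤ planeDet A e`, excludes the degenerate combinations in
Carathéodory's theorem. -/
theorem eq_zero_or_planeDet_pos_of_mem_hull {s : Set Plane} {e : Plane}
    (hs : ∀ v ∈ s, 0 < planeDet v e) {A : Plane} (hA : A ∈ PointedCone.hull ℝ s) :
    A = 0 ∨ 0 < planeDet A e := by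
  induction hA using Submodule.span_induction with
  | mem x hx => exact Or.inr (hs x hx)
  | zero => exact Or.inl rfl
  | add x y _ _ hx hy =>
    rcases hx with rfl | hx
    · rw [zero_add]; exact hy
    · rcases hy with rfl | hy
      · rw [add_zero]; exact Or.inr hx
      · right; rw [planeDet_add_left]; linarith
  | smul c x _ hx =>
    rcases hx with rfl | hx
    · left; exact smul_zero _
    · rcases c.2.eq_or_lt with h | h
      · left
        have : c = 0 := Subtype.ext h.symm
        rw [this, zero_smul]
      · right
        change 0 < planeDet ((c : ℝ) • x) e
        rw [planeDet_smul_left]; exact mul_pos h hx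

theorem planeDet_nonpos_of_mem_hull {s t : Set Plane}
    (hst : ∀ v ∈ s, ∀ w ∈ t, planeDet v w ≤ 0) {A B : Plane} (hA : A ∈ PointedCone.hull ℝ s)
    (hB : B ∈ PointedCone.hull ℝ t) : planeDet A B ≤ 0 := by
  have h1 : ∀ v ∈ s, planeDet v B ≤ 0 := by
    intro v hv
    induction hB using Submodule.span_induction with
    | mem x hx => exact hst v hv x hx
    | zero => simp [planeDet]
    | add x y _ _ hx hy => rw [planeDet_add_right]; linarith
    | smul c x _ hx =>
      change planeDet v ((c : ℝ) • x) ≤ 0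
      rw [planeDet_smul_right]; exact mul_nonpos_of_nonneg_of_nonpos c.2 hx
  induction hA using Submodule.span_induction with
  | mem x hx => exact h1 x hx
  | zero => simp [planeDet]
  | add x y _ _ hx hy => rw [planeDet_add_left]; linarith
  | smul c x _ hx =>
    change planeDet ((c : ℝ) • x) B ≤ 0
    rw [planeDet_smul_left]; exact mul_nonpos_of_nonneg_of_nonpos c.2 hx

theorem eq_or_eq_neg_of_ldet_eq_zero {e g : IntVec} (he : IrreducibleVec e)
    (hg : IrreducibleVec g) (h : ldet e g = 0) : g = e ∨ g = -e := by
  have hl := ldot_sq_add_ldet_sq e g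
  rw [h] at hl
  have hp := mul_pos he.ldot_self_pos hg.ldot_self_pos
  rcases lt_trichotomy (ldot e g) 0 with h1 | h1 | h1
  · right
    have hn : IrreducibleVec (-g) := by
      rw [IrreducibleVec, Prod.fst_neg, Prod.snd_neg, Int.gcd_neg, Int.neg_gcd]; exact hg
    have := eq_of_ldet_eq_zero he hn (by
      simp only [ldet, Prod.fst_neg, Prod.snd_neg] at h ⊢; linarith) (by
      simp only [ldot, Prod.fst_neg, Prod.snd_neg] at h1 ⊢; linarith)
    rw [this, neg_neg]
  · rw [h1] at hl; omega
  · exact Or.inl (eq_of_ldet_eq_zero he hg h h1).symm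

/-- Carathéodory's theorem for lattice cones of the plane. -/
theorem mem_or_exists_of_mem_latticeCone {V : Set IntVec} (hV : ∀ v ∈ V, IrreducibleVec v)
    {e : IntVec} (he : IrreducibleVec e) (hmem : latticeVec e ∈ latticeCone V) :
    e ∈ V ∨ ∃ v ∈ V, ∃ w ∈ V, 0 < ldet v e ∧ 0 < ldet e w ∧ 0 < ldet v w := by
  by_contra! hcon
  obtain ⟨heV, hcon⟩ := hcon
  -- Split `V` into the vectors on either side of `e`, and possibly `-e`. Then `E = A + B - c E`,
  -- with `A` and `B` in the cones of the two sides. If no pair had a positive determinant,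
  -- `planeDet A B ≤ 0`; but `planeDet A B = (1 + c) planeDet A E`, which is positive unless `A =
  -- 0`. If `A = 0`, then `B` is a positive multiple of `E`, contrary to its being on one strict
  -- side.
  set E := latticeVec e with hE
  set L : Set Plane := latticeVec '' {v | v ∈ V ∧ 0 < ldet v e} with hL
  set R : Set Plane := latticeVec '' {v | v ∈ V ∧ 0 < ldet e v} with hR
  have hsub : latticeVec '' V ⊆ L ∪ R ∪ {-E} := by
    rintro _ ⟨v, hv, rfl⟩
    rcases lt_trichotomy (ldet e v) 0 with h | h | h
    · exact Or.inl (Or.inl ⟨v, ⟨hv, by rw [ldet_swap]; omega⟩, rfl⟩)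
    · right
      rcases eq_or_eq_neg_of_ldet_eq_zero he (hV v hv) h with h1 | h1
      · exact absurd (h1 ▸ hv) heV
      · rw [h1, latticeVec_neg]; rfl
    · exact Or.inl (Or.inr ⟨v, ⟨hv, h⟩, rfl⟩)
  have hmem' : E ∈ PointedCone.hull ℝ (L ∪ R ∪ {-E}) := Submodule.span_mono hsub hmem
  rw [PointedCone.hull, Submodule.span_union, Submodule.span_union, Submodule.mem_sup] at hmem'
  obtain ⟨AB, hAB, N, hN, hsum⟩ := hmem'
  obtain ⟨A, hA, B, hB, rfl⟩ := Submodule.mem_sup.1 hAB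
  obtain ⟨c, rfl⟩ := Submodule.mem_span_singleton.1 hN
  have hc : (0 : ℝ) ≤ c := c.2
  have hsum' : A + B + (c : ℝ) • (-E) = E := hsum
  have hAB' : planeDet A B ≤ 0 := by
    refine planeDet_nonpos_of_mem_hull ?_ hA hB
    rintro _ ⟨v, ⟨hv, h1⟩, rfl⟩ _ ⟨w, ⟨hw, h2⟩, rfl⟩
    rw [planeDet_latticeVec]
    exact_mod_cast hcon v hv w hw h1 h2
  have hBe : B = (1 + (c : ℝ)) • E - A := by
    have h3 : B = (A + B + (c : ℝ) • (-E)) + (c : ℝ) • E - A := by module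
    rw [hsum'] at h3
    rw [h3]; module
  have hEne : E ≠ 0 := by
    intro h0
    have h1 := he.ldot_self_pos
    rw [hE, ← latticeVec_zero] at h0
    rw [latticeVec_injective h0] at h1
    simp [ldot] at h1
  have hB0 : B = 0 ∨ 0 < planeDet B (-E) := by
    refine eq_zero_or_planeDet_pos_of_mem_hull ?_ hB
    rintro _ ⟨w, ⟨hw, h2⟩, rfl⟩
    rw [hE, ← latticeVec_neg, planeDet_latticeVec]
    have : ldet w (-e) = ldet e w := by simp only [ldet, Prod.fst_neg, Prod.snd_neg]; ring
    rw [this]; exact_mod_cast h2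
  rcases eq_zero_or_planeDet_pos_of_mem_hull (e := E) (by
    rintro _ ⟨v, ⟨hv, h1⟩, rfl⟩
    rw [hE, planeDet_latticeVec]; exact_mod_cast h1) hA with hA0 | hA0
  · rw [hA0, sub_zero] at hBe
    rcases hB0 with h | h
    · rw [h] at hBe
      rcases smul_eq_zero.1 hBe.symm with h1 | h1
      · linarith
      · exact hEne h1
    · rw [hBe, planeDet_smul_left, ← neg_one_smul ℝ E, planeDet_smul_right, planeDet_self] at h
      simp at h
  · have : planeDet A B = (1 + (c : ℝ)) * planeDet A E := by
      rw [hBe, sub_eq_add_neg, planeDet_add_right, planeDet_smul_right, ← neg_one_smul ℝ A,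
        planeDet_smul_right, planeDet_self]; ring
    have h2 : 0 < (1 + (c : ℝ)) * planeDet A E := mul_pos (by linarith) hA0
    linarith

/-! ### The minimal family of stencils. -/

/-- The pairs `(x, e)` such that `e` has no parents, or one of the parents of `e` is not available
at `x`, or the parallelogram form of `(x, e)` is negative. -/
def refinementStencils (Ω : Set Plane) (h θ : ℝ) (ξ : Plane) (U : Plane → ℝ) :
    Set (Plane × IntVec) :=
  {p | p ∈ maxStencils Ω h θ ξ ∧ ∀ f g, IsParentPair f g p.2 → shift h θ p.1 f ∈ Ω →
    shift h θ p.1 g ∈ Ω → parallelogramForm h θ p.1 p.2 f g U < 0}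

section

variable {Ω : Set Plane} {U : Plane → ℝ} {h θ : ℝ} {ξ : Plane}

theorem refinementStencils_parents (hU : ConvexOn ℝ Ω U) {x : Plane} {e f g : IntVec}
    (he : (x, e) ∈ refinementStencils Ω h θ ξ U) (hp : IsParentPair f g e) :
    (shift h θ x f ∈ Ω → (x, f) ∈ refinementStencils Ω h θ ξ U) ∧
      (shift h θ x g ∈ Ω → (x, g) ∈ refinementStencils Ω h θ ξ U) := by
  have hx := he.1.1
  refine ⟨fun hf => ⟨(mem_maxStencils hx).2 ⟨hp.irreducible_left, hf⟩, fun f₁ f₂ h12 h1 h2 => ?_⟩,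
    fun hg => ⟨(mem_maxStencils hx).2 ⟨hp.irreducible_right, hg⟩, fun f₁ f₂ h12 h1 h2 => ?_⟩⟩
  · exact parallelogramForm_left_neg hU hx.1 hp he.1.2.2.1 (fun hg => he.2 f g hp hf hg) h12 h1 h2
  · exact parallelogramForm_right_neg hU hx.1 hp he.1.2.2.1 (fun hf => he.2 f g hp hf hg) h12 h1 h2

theorem latticeCone_mono {A B : Set IntVec} (hAB : A ⊆ B) : latticeCone A ⊆ latticeCone B :=
  Submodule.span_mono (Set.image_mono hAB)

theorem latticeVec_mem_latticeCone_refinementStencils {x : Plane}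
    (hx : x ∈ gridPoints Ω h θ ξ) (n : ℕ) :
    ∀ e, (ldot e e).toNat ≤ n → (x, e) ∈ maxStencils Ω h θ ξ →
      latticeVec e ∈ latticeCone (stencilAt (refinementStencils Ω h θ ξ U) x) := by
  induction n with
  | zero =>
    intro e hn he
    have : 0 < ldot e e := he.2.1.ldot_self_pos
    omega
  | succ n ih =>
    intro e hn he
    by_cases hG : (x, e) ∈ refinementStencils Ω h θ ξ U
    · exact Submodule.subset_span ⟨e, hG, rfl⟩
    · have : ∃ f g, IsParentPair f g e ∧ shift h θ x f ∈ Ω ∧ shift h θ x g ∈ Ω := by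
        by_contra! hcon
        exact hG ⟨he, fun f g hp hf hg => absurd hg (hcon f g hp hf)⟩
      obtain ⟨f, g, hp, hf, hg⟩ := this
      have l1 := hp.ldot_self_left_lt
      have l2 := hp.ldot_self_right_lt
      rw [hp.2.2, latticeVec_add]
      exact Submodule.add_mem _
        (ih f (by omega) ((mem_maxStencils hx).2 ⟨hp.irreducible_left, hf⟩))
        (ih g (by omega) ((mem_maxStencils hx).2 ⟨hp.irreducible_right, hg⟩))

theorem refinementStencils_mem_admissible (hU : ConvexOn ℝ Ω U) :
    refinementStencils Ω h θ ξ U ∈ admissibleStencils Ω h θ ξ U := by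
  refine ⟨⟨fun p hp => hp.1, ?_, ?_⟩, ⟨?_, ?_, ?_⟩⟩
  · rintro x e f he ⟨g, hp | hp⟩ hf
    · exact (refinementStencils_parents hU he hp).1 hf.2.2.1
    · exact (refinementStencils_parents hU he hp).2 hf.2.2.1
  · intro x hx
    refine Set.Subset.antisymm (latticeCone_mono fun e he => he.1) ?_
    refine Submodule.span_le.2 ?_
    rintro _ ⟨e, he, rfl⟩
    exact latticeVec_mem_latticeCone_refinementStencils hx _ e le_rfl he
  · intro x e he h1
    exact segmentForm_nonneg hU he.1.2.2.1 h1.1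
  · intro x e f g he hp h1 h2
    exact triangleForm_nonneg hU hp he.1.2.2.1 h1.1 h2.1
  · intro x e f g hmax hnot hp hf hg
    by_contra! hcon
    refine hnot ⟨hmax, fun f' g' hp' _ _ => ?_⟩
    obtain ⟨rfl, rfl⟩ := hp.unique hp'
    exact hcon

/-- Minimality, by induction on the norm. If `V` misses a refined `e`, visibility and stability of
`V` make both parents available; they are refined, hence in `V`, and the parallelogram inequality of
`V` contradicts the negativity of the form at `e`. -/
theorem mem_of_mem_refinementStencils (hU : ConvexOn ℝ Ω U) {V : Set (Plane × IntVec)}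
    (hV : V ∈ admissibleStencils Ω h θ ξ U) {x : Plane} (n : ℕ) :
    ∀ e, (ldot e e).toNat ≤ n → (x, e) ∈ refinementStencils Ω h θ ξ U → (x, e) ∈ V := by
  induction n with
  | zero =>
    intro e hn he
    have : 0 < ldot e e := he.1.2.1.ldot_self_pos
    omega
  | succ n ih =>
    intro e hn he
    by_contra hnot
    have hx := he.1.1
    have hVi : ∀ v ∈ stencilAt V x, IrreducibleVec v := fun v hv => (hV.1.subset_max hv).2.1
    have hVS : stencilAt V x ⊆ availableOffsets Ω h θ x := fun v hv =>
      (hV.1.subset_max hv).2.2.1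
    have hst : StableIn (availableOffsets Ω h θ x) (stencilAt V x) := fun v hv f g hp =>
      ⟨fun hf => hV.1.stability x v f hv ⟨g, Or.inl hp⟩
        ((mem_maxStencils hx).2 ⟨hp.irreducible_left, hf⟩),
      fun hg => hV.1.stability x v g hv ⟨f, Or.inr hp⟩
        ((mem_maxStencils hx).2 ⟨hp.irreducible_right, hg⟩)⟩
    have hcone : latticeVec e ∈ latticeCone (stencilAt V x) := by
      rw [hV.1.visibility x hx]
      exact Submodule.subset_span ⟨e, he.1, rfl⟩
    have hpar : ∃ f g, IsParentPair f g e ∧ f ∈ availableOffsets Ω h θ x ∧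
        g ∈ availableOffsets Ω h θ x := by
      rcases mem_or_exists_of_mem_latticeCone hVi he.1.2.1 hcone with
        h1 | ⟨v, hv, w, hw, h1, h2, h3⟩
      · exact absurd h1 hnot
      · rcases mem_or_parents_mem (latticeConvex_availableOffsets hU.1 h θ hx.1) hVi hVS hst
          he.1.2.1 he.1.2.2.1 hv hw h1 h2 h3 with h4 | h4
        · exact absurd h4 hnot
        · exact h4
    obtain ⟨f, g, hp, hf, hg⟩ := hpar
    have l1 := hp.ldot_self_left_lt
    have l2 := hp.ldot_self_right_lt
    have hstab := refinementStencils_parents hU he hp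
    have hfV := ih f (by omega) (hstab.1 hf)
    have hgV := ih g (by omega) (hstab.2 hg)
    have h1 := hV.2.parallelogram x e f g he.1 hnot hp hfV hgV
    have h2 := he.2 f g hp hf hg
    linarith

theorem isLeast_refinementStencils (hU : ConvexOn ℝ Ω U) :
    IsLeast (admissibleStencils Ω h θ ξ U) (refinementStencils Ω h θ ξ U) :=
  ⟨refinementStencils_mem_admissible hU,
    fun _ hV p hp => mem_of_mem_refinementStencils hU hV _ p.2 le_rfl hp⟩

theorem minimalStencils_eq (hU : ConvexOn ℝ Ω U) :
    minimalStencils Ω h θ ξ U = refinementStencils Ω h θ ξ U :=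
  Set.Subset.antisymm (Set.sInter_subset_of_mem (isLeast_refinementStencils hU).1)
    (Set.subset_sInter (isLeast_refinementStencils hU).2)

end

/-! ### The angles at which a vector is refined around a fixed centre. -/

/-- The pair `(x, e)` lies in the set and `e` belongs to the refined stencil at `x`, up to the
requirements that `x` lies on the grid and that `e` is irreducible. -/
def IsRefined (Ω : Set Plane) (U : Plane → ℝ) (h : ℝ) (e : IntVec) (θ : ℝ) (x : Plane) : Prop :=
  x ∈ Ω ∧ shift h θ x e ∈ Ω ∧ ∀ f g, IsParentPair f g e → shift h θ x f ∈ Ω →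
    shift h θ x g ∈ Ω → parallelogramForm h θ x e f g U < 0

theorem smul_add_smul_mem_of_symmetric {S : Set Plane} (hS : Convex ℝ S)
    (hsymm : ∀ v ∈ S, -v ∈ S) {a b : Plane} (ha : a ∈ S) (hb : b ∈ S) {s t : ℝ}
    (hst : |s| + |t| ≤ 1) : s • a + t • b ∈ S := by
  have key : ∀ {a b : Plane} (_ : a ∈ S) (_ : b ∈ S) {s t : ℝ}, 0 ≤ s → 0 ≤ t → s + t ≤ 1 →
      s • a + t • b ∈ S := by
    intro a b ha hb s t hs ht hst
    have h0 : (0 : Plane) ∈ S := by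
      have := hS ha (hsymm a ha) (show (0 : ℝ) ≤ 1 / 2 by norm_num)
        (show (0 : ℝ) ≤ 1 / 2 by norm_num) (by norm_num)
      rwa [smul_neg, add_neg_cancel] at this
    rcases (add_nonneg hs ht).eq_or_lt with h | h
    · have h1 : s = 0 := by linarith
      have h2 : t = 0 := by linarith
      simpa [h1, h2] using h0
    · have hm := hS ha hb (div_nonneg hs h.le) (div_nonneg ht h.le)
        (by rw [← add_div, div_self h.ne'])
      have := hS h0 hm (show 0 ≤ 1 - (s + t) by linarith) h.le (by ring)
      rw [smul_zero, zero_add, smul_add, smul_smul, smul_smul, mul_div_cancel₀ _ h.ne',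
        mul_div_cancel₀ _ h.ne'] at this
      exact this
  rcases le_total 0 s with hs | hs <;> rcases le_total 0 t with ht | ht
  · rw [abs_of_nonneg hs, abs_of_nonneg ht] at hst
    exact key ha hb hs ht hst
  · rw [abs_of_nonneg hs, abs_of_nonpos ht] at hst
    simpa using key ha (hsymm b hb) hs (neg_nonneg.2 ht) hst
  · rw [abs_of_nonpos hs, abs_of_nonneg ht] at hst
    simpa using key (hsymm a ha) hb (neg_nonneg.2 hs) ht hst
  · rw [abs_of_nonpos hs, abs_of_nonpos ht] at hst
    simpa using key (hsymm a ha) (hsymm b hb) (neg_nonneg.2 hs) (neg_nonneg.2 ht) hst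

/-- For an acute basis `(f, g)` with sum `e`, the rotated difference `R_β (f - g)` is a sub-convex
combination of `± R_α e` and `± R_β e` as soon as the angle between the rotations is large. -/
theorem IsParentPair.exists_rotate_sub_eq {f g e : IntVec} (hp : IsParentPair f g e) {α β : ℝ}
    (hs : 2 ≤ |Real.sin (β - α)| * min (ldot f e) (ldot g e)) :
    ∃ s t : ℝ, |s| + |t| ≤ 1 ∧ rotate β (latticeVec f - latticeVec g) =
      s • rotate α (latticeVec e) + t • rotate β (latticeVec e) := by
  obtain ⟨p, hpd⟩ : ∃ p : ℝ, p = ldot f e := ⟨_, rfl⟩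
  obtain ⟨q, hqd⟩ : ∃ q : ℝ, q = ldot g e := ⟨_, rfl⟩
  have hp0 : 0 < p := by rw [hpd]; exact_mod_cast hp.ldot_left_pos
  have hq0 : 0 < q := by rw [hqd]; exact_mod_cast hp.ldot_right_pos
  have hs' : 2 ≤ |Real.sin (β - α)| * min p q := by
    rw [hpd, hqd]; exact_mod_cast hs
  set σ := Real.sin (β - α) with hσ
  set κ := Real.cos (β - α) with hκ
  have hσ0 : σ ≠ 0 := by
    intro h0
    rw [h0, abs_zero, zero_mul] at hs'
    norm_num at hs'
  have hσp : 0 < |σ| := abs_pos.2 hσ0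
  have hE : 0 < p + q := by linarith
  -- With `J` the quarter turn, `(p + q)(f - g) = (p - q) e - 2 J e`, and `R_α e = κ R_β e - σ R_β J
  -- e` eliminates `J e`. Then `|s| + |t| ≤ |p - q|/(p + q) + 4/((p + q)|σ|)`, which is at most 1
  -- exactly when `|σ| min p q ≥ 2`.
  refine ⟨2 / ((p + q) * σ), (p - q) / (p + q) - 2 / ((p + q) * σ) * κ, ?_, ?_⟩
  · have h1 : |2 / ((p + q) * σ)| = 2 / ((p + q) * |σ|) := by
      rw [abs_div, abs_mul, abs_of_pos hE, abs_two]
    have h2 : |(p - q) / (p + q) - 2 / ((p + q) * σ) * κ| ≤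
        |p - q| / (p + q) + 2 / ((p + q) * |σ|) := by
      refine (abs_sub _ _).trans ?_
      rw [abs_div, abs_of_pos hE, abs_mul, h1]
      gcongr
      exact mul_le_of_le_one_right (by positivity) (Real.abs_cos_le_one _)
    have h3 : |p - q| = p + q - 2 * min p q := by
      rcases le_total p q with h | h
      · rw [min_eq_left h, abs_of_nonpos (by linarith)]; ring
      · rw [min_eq_right h, abs_of_nonneg (by linarith)]; ring
    have h4 : 2 / ((p + q) * |σ|) ≤ min p q / (p + q) := by
      rw [div_le_div_iff₀ (by positivity) hE]
      nlinarith
    have h5 : |p - q| / (p + q) + 2 * (min p q / (p + q)) = 1 := by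
      rw [h3]; field_simp; ring
    rw [h1]
    linarith
  · have hdet : (f.1 : ℝ) * g.2 - f.2 * g.1 = 1 := by exact_mod_cast hp.1
    have hpe : p = f.1 * (f.1 + g.1) + f.2 * (f.2 + g.2) := by
      rw [hpd, hp.2.2]; simp [ldot]
    have hqe : q = g.1 * (f.1 + g.1) + g.2 * (f.2 + g.2) := by
      rw [hqd, hp.2.2]; simp [ldot]
    have hx : (p + q) * ((f.1 : ℝ) - g.1) = (p - q) * (f.1 + g.1) + 2 * (f.2 + g.2) := by
      rw [hpe, hqe]; linear_combination (2 * ((f.2 : ℝ) + g.2)) * hdet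
    have hy : (p + q) * ((f.2 : ℝ) - g.2) = (p - q) * (f.2 + g.2) - 2 * (f.1 + g.1) := by
      rw [hpe, hqe]; linear_combination (-2 * ((f.1 : ℝ) + g.1)) * hdet
    have hσe : σ = Real.sin β * Real.cos α - Real.cos β * Real.sin α := Real.sin_sub _ _
    have hκe : κ = Real.cos β * Real.cos α + Real.sin β * Real.sin α := Real.cos_sub _ _
    have hpy := Real.sin_sq_add_cos_sq β
    have k1 : κ * Real.cos β + σ * Real.sin β = Real.cos α := by
      rw [hσe, hκe]; linear_combination (Real.cos α) * hpy
    have k2 : κ * Real.sin β - σ * Real.cos β = Real.sin α := by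
      rw [hσe, hκe]; linear_combination (Real.sin α) * hpy
    have hne : (p + q) * σ ≠ 0 := mul_ne_zero hE.ne' hσ0
    have hexp : (p - q) / (p + q) - 2 / ((p + q) * σ) * κ =
        ((p - q) * σ - 2 * κ) / ((p + q) * σ) := by
      field_simp
    rw [hexp, hp.2.2]
    refine (smul_right_injective Plane hne) ?_
    simp only [smul_add, smul_smul, mul_div_cancel₀ _ hne]
    ext i
    fin_cases i
    · simp [rotate, latticeVec]
      rw [← k1, ← k2]
      linear_combination (σ * Real.cos β) * hx - (σ * Real.sin β) * hy
    · simp [rotate, latticeVec]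
      rw [← k1, ← k2]
      linear_combination (σ * Real.sin β) * hx + (σ * Real.cos β) * hy

/-- Around the centre `c`, negativity of the form compares the even convex function `φ` on the two
half-diagonals: `φ (A θ) < φ (B θ)`. For well separated angles, both `B α` and `B β` lie in the
convex hull of `±A α`, `±A β`. -/
theorem IsRefined.abs_sin_mul_lt {Ω : Set Plane} {U : Plane → ℝ} (hU : ConvexOn ℝ Ω U) {h : ℝ}
    {f g e : IntVec} (hp : IsParentPair f g e) {c : Plane} {α β : ℝ}
    (hα : IsRefined Ω U h e α (c - (h / 2) • rotate α (latticeVec e)))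
    (hβ : IsRefined Ω U h e β (c - (h / 2) • rotate β (latticeVec e))) :
    |Real.sin (β - α)| * min (ldot f e) (ldot g e) < 2 := by
  by_contra! hcon
  set D : Set Plane := {v | c + v ∈ Ω ∧ c - v ∈ Ω} with hD
  set φ : Plane → ℝ := fun v => U (c + v) + U (c - v) with hφ
  have e1 : ∀ (v w : Plane) (a b : ℝ), a + b = 1 →
      c + (a • v + b • w) = a • (c + v) + b • (c + w) := by
    intro v w a b hab
    have : c = a • c + b • c := by rw [← add_smul, hab, one_smul]
    nth_rw 1 [this]; module
  have e2 : ∀ (v w : Plane) (a b : ℝ), a + b = 1 →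
      c - (a • v + b • w) = a • (c - v) + b • (c - w) := by
    intro v w a b hab
    have : c = a • c + b • c := by rw [← add_smul, hab, one_smul]
    nth_rw 1 [this]; module
  have hφc : ConvexOn ℝ D φ := by
    refine ⟨fun v hv w hw a b ha hb hab => ⟨?_, ?_⟩, fun v hv w hw a b ha hb hab => ?_⟩
    · rw [e1 v w a b hab]; exact hU.1 hv.1 hw.1 ha hb hab
    · rw [e2 v w a b hab]; exact hU.1 hv.2 hw.2 ha hb hab
    · have k1 := hU.2 hv.1 hw.1 ha hb hab
      have k2 := hU.2 hv.2 hw.2 ha hb hab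
      simp only [hφ, e1 v w a b hab, e2 v w a b hab, smul_eq_mul] at k1 k2 ⊢
      linarith
  set A : ℝ → Plane := fun θ => (h / 2) • rotate θ (latticeVec e) with hA
  set B : ℝ → Plane := fun θ => (h / 2) • rotate θ (latticeVec f - latticeVec g) with hB
  have s0 : ∀ θ, shift h θ (c - (h / 2) • rotate θ (latticeVec e)) e = c + A θ := by
    intro θ; simp only [shift, hA]; module
  have s1 : ∀ θ, shift h θ (c - (h / 2) • rotate θ (latticeVec e)) f = c + B θ := by
    intro θ
    simp only [shift, hB, hp.2.2, latticeVec_add, rotate_add, sub_eq_add_neg, rotate_neg_vec]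
    module
  have s2 : ∀ θ, shift h θ (c - (h / 2) • rotate θ (latticeVec e)) g = c - B θ := by
    intro θ
    simp only [shift, hB, hp.2.2, latticeVec_add, rotate_add, sub_eq_add_neg, rotate_neg_vec]
    module
  have mem : ∀ {θ}, IsRefined Ω U h e θ (c - (h / 2) • rotate θ (latticeVec e)) → A θ ∈ D :=
    fun {θ} hθ => ⟨s0 θ ▸ hθ.2.1, hθ.1⟩
  have lt : ∀ {θ}, IsRefined Ω U h e θ (c - (h / 2) • rotate θ (latticeVec e)) → B θ ∈ D →
      φ (A θ) < φ (B θ) := by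
    intro θ hθ hBD
    have := hθ.2.2 f g hp (s1 θ ▸ hBD.1) (s2 θ ▸ hBD.2)
    rw [parallelogramForm, s0, s1, s2] at this
    simp only [hφ]
    linarith
  -- The sublevel set `S` is convex, symmetric and contained in `D`. So `B θ ∈ S` gives both `φ (B
  -- θ) ≤ m` and the availability of the parents, which refinement needs in order to yield a strict
  -- inequality. The angle attaining `m` gives the contradiction.
  set m := max (φ (A α)) (φ (A β)) with hm
  set S : Set Plane := {v ∈ D | φ v ≤ m} with hS
  have hSc : Convex ℝ S := hφc.convex_le m
  have hSs : ∀ v ∈ S, -v ∈ S := by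
    rintro v ⟨⟨h1, h2⟩, h3⟩
    refine ⟨⟨by rwa [← sub_eq_add_neg], by rwa [sub_neg_eq_add]⟩, ?_⟩
    simp only [hφ, sub_neg_eq_add, ← sub_eq_add_neg] at h3 ⊢
    linarith
  have hAα : A α ∈ S := ⟨mem hα, le_max_left _ _⟩
  have hAβ : A β ∈ S := ⟨mem hβ, le_max_right _ _⟩
  have hBβ : B β ∈ S := by
    obtain ⟨s, t, hst, heq⟩ := hp.exists_rotate_sub_eq (α := α) (β := β) (by exact_mod_cast hcon)
    have : B β = s • A α + t • A β := by simp only [hB, hA, heq]; module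
    rw [this]
    exact smul_add_smul_mem_of_symmetric hSc hSs hAα hAβ hst
  have hBα : B α ∈ S := by
    obtain ⟨s, t, hst, heq⟩ := hp.exists_rotate_sub_eq (α := β) (β := α) (by
      rw [← neg_sub, Real.sin_neg, abs_neg]; exact_mod_cast hcon)
    have : B α = s • A β + t • A α := by simp only [hB, hA, heq]; module
    rw [this]
    exact smul_add_smul_mem_of_symmetric hSc hSs hAβ hAα hst
  rcases max_choice (φ (A α)) (φ (A β)) with h1 | h1
  · have := lt hα hBα.1
    have := hBα.2
    rw [hm, h1] at this
    linarith
  · have := lt hβ hBβ.1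
    have := hBβ.2
    rw [hm, h1] at this
    linarith

/-- The angles for which a given centre is that of a refined segment fill a set of small
measure. -/
theorem volume_refined_angles_le {Ω : Set Plane} {U : Plane → ℝ} (hU : ConvexOn ℝ Ω U) {h : ℝ}
    {f g e : IntVec} (hp : IsParentPair f g e) (c : Plane) :
    volume {θ ∈ Set.Icc (0 : ℝ) (Real.pi / 2) |
      IsRefined Ω U h e θ (c - (h / 2) • rotate θ (latticeVec e))} ≤
      ENNReal.ofReal (Real.pi * (1 / ldot f e + 1 / ldot g e)) := by
  refine (Real.volume_le_diam _).trans (Metric.ediam_le ?_)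
  rintro α ⟨hα, hα'⟩ β ⟨hβ, hβ'⟩
  rw [edist_dist]
  refine ENNReal.ofReal_le_ofReal ?_
  have hlt := IsRefined.abs_sin_mul_lt hU hp hβ' hα'
  have hp0 : (0 : ℝ) < ldot f e := by exact_mod_cast hp.ldot_left_pos
  have hq0 : (0 : ℝ) < ldot g e := by exact_mod_cast hp.ldot_right_pos
  -- Jordan's inequality applies because angles in `[0, π/2]` differ by at most `π/2`.
  have hsin := Real.mul_abs_le_abs_sin (x := α - β) (abs_le.2
    ⟨by linarith [hα.1, hβ.2], by linarith [hα.2, hβ.1]⟩)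
  push_cast at hlt
  set m := min (ldot f e : ℝ) (ldot g e : ℝ) with hm
  have hm0 : 0 < m := lt_min hp0 hq0
  have h1 : 2 / Real.pi * |α - β| * m < 2 := (mul_le_mul_of_nonneg_right hsin hm0.le).trans_lt hlt
  have h2 : |α - β| ≤ Real.pi * (1 / m) := by
    have hpi := Real.pi_pos
    rw [mul_one_div, le_div_iff₀ hm0]
    have h3 : 2 / Real.pi * |α - β| * m = 2 * (|α - β| * m) / Real.pi := by ring
    rw [h3, div_lt_iff₀ hpi] at h1
    linarith
  rw [Real.dist_eq]
  refine h2.trans (mul_le_mul_of_nonneg_left ?_ Real.pi_pos.le)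
  rcases min_choice (ldot f e : ℝ) (ldot g e : ℝ) with h3 | h3
  · rw [hm, h3]; have := one_div_pos.2 hq0; linarith
  · rw [hm, h3]; have := one_div_pos.2 hp0; linarith

/-! ### The sum over acute bases. -/

theorem harmonic_cast_eq (N : ℕ) : ((harmonic N : ℚ) : ℝ) = ∑ k ∈ Finset.Icc 1 N, 1 / (k : ℝ) := by
  rw [harmonic_eq_sum_Icc]; push_cast; simp only [one_div]

theorem harmonic_cast_nonneg (N : ℕ) : (0 : ℝ) ≤ harmonic N := by
  rw [harmonic_cast_eq]; positivity

theorem sum_Icc_neg_one_div_abs (N : ℕ) :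
    ∑ a ∈ Finset.Icc (-(N : ℤ)) N, 1 / |(a : ℝ)| = 2 * harmonic N := by
  have heven : Function.Even (fun a : ℤ => 1 / |(a : ℝ)|) := by
    intro a; simp
  rw [Finset.sum_Icc_of_even_eq_range heven N, harmonic_cast_eq, Finset.range_eq_Ico,
    Finset.sum_eq_sum_Ico_succ_bot (Nat.succ_pos N)]
  simp
  rfl

theorem sum_Icc_ite_abs_le (N : ℕ) (a : ℤ) :
    ∑ b ∈ Finset.Icc (-(N : ℤ)) N, (if a ≠ 0 ∧ |b| ≤ |a| then 1 / (a : ℝ) ^ 2 else 0) ≤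
      3 * (1 / |(a : ℝ)|) := by
  by_cases ha : a = 0
  · simp [ha]
  have ha1 : (1 : ℝ) ≤ |(a : ℝ)| := by exact_mod_cast Int.one_le_abs ha
  rw [← Finset.sum_filter, Finset.sum_const, nsmul_eq_mul]
  have hcard : ((Finset.filter (fun b => a ≠ 0 ∧ |b| ≤ |a|) (Finset.Icc (-(N : ℤ)) N)).card : ℝ) ≤
      2 * |(a : ℝ)| + 1 := by
    have h1 : Finset.filter (fun b => a ≠ 0 ∧ |b| ≤ |a|) (Finset.Icc (-(N : ℤ)) N) ⊆
        Finset.Icc (-|a|) |a| := by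
      intro b hb
      exact Finset.mem_Icc.2 (abs_le.1 (Finset.mem_filter.1 hb).2.2)
    have h2 := Finset.card_le_card h1
    rw [Int.card_Icc] at h2
    have h3 : ((Finset.filter (fun b => a ≠ 0 ∧ |b| ≤ |a|)
        (Finset.Icc (-(N : ℤ)) N)).card : ℤ) ≤ 2 * |a| + 1 := by
      have := abs_nonneg a
      omega
    exact_mod_cast h3
  calc _ ≤ (2 * |(a : ℝ)| + 1) * (1 / (a : ℝ) ^ 2) :=
        mul_le_mul_of_nonneg_right hcard (by positivity)
    _ ≤ (3 * |(a : ℝ)|) * (1 / (a : ℝ) ^ 2) :=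
        mul_le_mul_of_nonneg_right (by linarith) (by positivity)
    _ = 3 * (1 / |(a : ℝ)|) := by
        rw [← sq_abs (a : ℝ)]; field_simp

/-- Bound `|f|²` below by the square of the larger coordinate, and count the at most `2|a| + 1 ≤
3|a|` values of the other one. The zero vector contributes nothing, since `1 / 0 = 0`. -/
theorem sum_box_one_div_ldot_self_le (N : ℕ) :
    ∑ f ∈ Finset.Icc (-(N : ℤ)) N ×ˢ Finset.Icc (-(N : ℤ)) N, 1 / (ldot f f : ℝ) ≤
      12 * harmonic N := by
  set I := Finset.Icc (-(N : ℤ)) N with hI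
  have hpt : ∀ f ∈ I ×ˢ I, 1 / (ldot f f : ℝ) ≤
      (if f.1 ≠ 0 ∧ |f.2| ≤ |f.1| then 1 / (f.1 : ℝ) ^ 2 else 0) +
      (if f.2 ≠ 0 ∧ |f.1| ≤ |f.2| then 1 / (f.2 : ℝ) ^ 2 else 0) := by
    rintro ⟨a, b⟩ -
    have hl : (ldot (a, b) (a, b) : ℝ) = (a : ℝ) ^ 2 + (b : ℝ) ^ 2 := by
      simp [ldot]; ring
    rw [hl]
    have n1 : (0 : ℝ) ≤ if a ≠ 0 ∧ |b| ≤ |a| then 1 / (a : ℝ) ^ 2 else 0 := by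
      split_ifs <;> positivity
    have n2 : (0 : ℝ) ≤ if b ≠ 0 ∧ |a| ≤ |b| then 1 / (b : ℝ) ^ 2 else 0 := by
      split_ifs <;> positivity
    rcases le_total |b| |a| with h | h
    · by_cases ha : a = 0
      · have hb : b = 0 := by rw [ha, abs_zero] at h; exact abs_nonpos_iff.1 h
        simp [ha, hb]
      · refine le_trans ?_ (le_add_of_nonneg_right n2)
        simp only [ha, h, ne_eq, not_false_eq_true, and_self, if_true]
        have : (0 : ℝ) < (a : ℝ) ^ 2 := by positivity
        exact one_div_le_one_div_of_le this (by nlinarith [sq_nonneg (b : ℝ)])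
    · by_cases hb : b = 0
      · have ha : a = 0 := by rw [hb, abs_zero] at h; exact abs_nonpos_iff.1 h
        simp [ha, hb]
      · refine le_trans ?_ (le_add_of_nonneg_left n1)
        simp only [hb, h, ne_eq, not_false_eq_true, and_self, if_true]
        have : (0 : ℝ) < (b : ℝ) ^ 2 := by positivity
        exact one_div_le_one_div_of_le this (by nlinarith [sq_nonneg (a : ℝ)])
  have hbound : ∑ a ∈ I, 3 * (1 / |(a : ℝ)|) = 6 * harmonic N := by
    rw [← Finset.mul_sum, hI, sum_Icc_neg_one_div_abs]; ring
  calc _ ≤ _ := Finset.sum_le_sum hpt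
    _ ≤ 6 * (harmonic N : ℝ) + 6 * harmonic N := by
        rw [Finset.sum_add_distrib]
        refine add_le_add ?_ ?_
        · rw [Finset.sum_product, ← hbound]
          exact Finset.sum_le_sum fun a _ => sum_Icc_ite_abs_le N a
        · rw [Finset.sum_product_right, ← hbound]
          exact Finset.sum_le_sum fun a _ => sum_Icc_ite_abs_le N a
    _ = 12 * harmonic N := by ring

theorem mem_Icc_of_ldot_self_le {f : IntVec} {N : ℕ} (h : ldot f f ≤ (N : ℤ) ^ 2) :
    f ∈ Finset.Icc (-(N : ℤ)) N ×ˢ Finset.Icc (-(N : ℤ)) N := by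
  simp only [ldot] at h
  have h1 : |f.1| ≤ N := abs_le_of_sq_le_sq (by nlinarith [mul_self_nonneg f.2]) (by positivity)
  have h2 : |f.2| ≤ N := abs_le_of_sq_le_sq (by nlinarith [mul_self_nonneg f.1]) (by positivity)
  exact Finset.mem_product.2 ⟨Finset.mem_Icc.2 (abs_le.1 h1), Finset.mem_Icc.2 (abs_le.1 h2)⟩

/-- The vectors `e` with a given parent `F e` differ by multiples of it, so `e` is determined by `F
e` and the integer quotient `κ e` of `⟨F e, e⟩` by `|F e|²`. As `⟨F e, e⟩ ≥ κ e |F e|²`, the sum is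
at most a product of a sum over `F e` and a harmonic sum over `κ e`. The sign `s` covers first and
second parents at once. -/
theorem sum_one_div_ldot_parent_le (N : ℕ) (T : Finset IntVec) (F : IntVec → IntVec) (s : ℤ)
    (hs : s * s = 1) (hdet : ∀ e ∈ T, ldet (F e) e = s) (hpos : ∀ e ∈ T, 0 < ldot (F e) (F e))
    (hle : ∀ e ∈ T, ldot (F e) (F e) ≤ ldot (F e) e) (hT : ∀ e ∈ T, ldot e e ≤ (N : ℤ) ^ 2) :
    ∑ e ∈ T, 1 / (ldot (F e) e : ℝ) ≤ harmonic N * (12 * harmonic N) := by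
  set κ : IntVec → ℕ := fun e => (ldot (F e) e / ldot (F e) (F e)).toNat with hκ
  have hκ1 : ∀ e ∈ T, 1 ≤ ldot (F e) e / ldot (F e) (F e) := fun e he =>
    (Int.le_ediv_iff_mul_le (hpos e he)).2 (by linarith [hle e he])
  have hκc : ∀ e ∈ T, (κ e : ℤ) = ldot (F e) e / ldot (F e) (F e) := fun e he =>
    Int.toNat_of_nonneg (by linarith [hκ1 e he])
  have hκle : ∀ e ∈ T, (κ e : ℤ) * ldot (F e) (F e) ≤ ldot (F e) e := fun e he => by
    rw [hκc e he]; exact Int.ediv_mul_le _ (hpos e he).ne'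
  have hCS : ∀ e, ldot (F e) e ^ 2 ≤ ldot (F e) (F e) * ldot e e := fun e => by
    have := ldot_sq_add_ldet_sq (F e) e
    nlinarith [sq_nonneg (ldet (F e) e)]
  have hinj : Set.InjOn (fun e => (F e, κ e)) T := by
    intro e he e' he' heq
    simp only [Prod.mk.injEq] at heq
    obtain ⟨h1, h2⟩ := heq
    have hprim : ldet (F e') (s • e') = 1 := by
      have : ldet (F e') (s • e') = s * ldet (F e') e' := by
        simp only [ldet, Prod.smul_fst, Prod.smul_snd, smul_eq_mul]; ring
      rw [this, hdet e' he', hs]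
    obtain ⟨k, hk⟩ := exists_eq_add_smul_of_ldet_eq (a := e) (b := e') hprim (by
      rw [hdet e' he', ← h1, hdet e he])
    have h3 : ldot (F e') e = ldot (F e') e' + k * ldot (F e') (F e') := by
      rw [← ldot_smul_right, ← ldot_add_right, ← hk]
    have h4 : (κ e : ℤ) = κ e' := by rw [h2]
    rw [hκc e he, hκc e' he', h1, h3, Int.add_mul_ediv_right _ _ (hpos e' he').ne'] at h4
    have : k = 0 := by omega
    rw [hk, this, zero_smul, add_zero]
  have hterm : ∀ e ∈ T, 1 / (ldot (F e) e : ℝ) ≤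
      (fun p : IntVec × ℕ => 1 / (ldot p.1 p.1 : ℝ) * (1 / (p.2 : ℝ))) (F e, κ e) := by
    intro e he
    have h1 : (0 : ℝ) < ldot (F e) (F e) := by exact_mod_cast hpos e he
    have h2 : (0 : ℝ) < κ e := by
      have : (0 : ℤ) < κ e := by rw [hκc e he]; linarith [hκ1 e he]
      exact_mod_cast this
    simp only
    rw [one_div_mul_one_div]
    refine one_div_le_one_div_of_le (by positivity) ?_
    have := hκle e he
    rw [mul_comm]
    exact_mod_cast this
  have hsub : T.image (fun e => (F e, κ e)) ⊆
      (Finset.Icc (-(N : ℤ)) N ×ˢ Finset.Icc (-(N : ℤ)) N) ×ˢ Finset.Icc 1 N := by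
    intro p hp
    obtain ⟨e, he, rfl⟩ := Finset.mem_image.1 hp
    have a1 := hpos e he
    have a2 := hle e he
    have a3 := hCS e
    have a4 := hT e he
    have a5 : ldot (F e) (F e) ≤ ldot e e := by
      by_contra! hc
      nlinarith
    refine Finset.mem_product.2 ⟨mem_Icc_of_ldot_self_le (a5.trans a4), Finset.mem_Icc.2 ⟨?_, ?_⟩⟩
    · have := hκ1 e he
      rw [← hκc e he] at this
      exact_mod_cast this
    -- Cauchy–Schwarz gives `κ e |F e| ≤ |e| ≤ N`.
    · have a6 := hκle e he
      have a7 : (κ e : ℤ) ^ 2 * ldot (F e) (F e) ^ 2 ≤ ldot (F e) (F e) * ldot e e := by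
        rw [← mul_pow]
        exact (pow_le_pow_left₀ (by positivity) a6 2).trans a3
      have a8 : (κ e : ℤ) ^ 2 * ldot (F e) (F e) ≤ ldot e e := by
        refine le_of_mul_le_mul_left ?_ a1
        calc _ = (κ e : ℤ) ^ 2 * ldot (F e) (F e) ^ 2 := by ring
          _ ≤ _ := a7
      have a9 : (κ e : ℤ) ^ 2 ≤ (N : ℤ) ^ 2 := by
        nlinarith [sq_nonneg (κ e : ℤ)]
      have a10 := abs_le_of_sq_le_sq a9 (by positivity)
      have := le_of_abs_le a10
      change κ e ≤ N
      exact_mod_cast this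
  calc _ ≤ ∑ e ∈ T, _ := Finset.sum_le_sum hterm
    _ = ∑ p ∈ T.image (fun e => (F e, κ e)), 1 / (ldot p.1 p.1 : ℝ) * (1 / (p.2 : ℝ)) :=
        (Finset.sum_image (f := fun p : IntVec × ℕ => 1 / (ldot p.1 p.1 : ℝ) * (1 / (p.2 : ℝ)))
          hinj).symm
    _ ≤ ∑ p ∈ (Finset.Icc (-(N : ℤ)) N ×ˢ Finset.Icc (-(N : ℤ)) N) ×ˢ Finset.Icc 1 N,
        1 / (ldot p.1 p.1 : ℝ) * (1 / (p.2 : ℝ)) := by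
        refine Finset.sum_le_sum_of_subset_of_nonneg hsub fun p _ _ => ?_
        have : (0 : ℝ) ≤ ldot p.1 p.1 := by exact_mod_cast ldot_self_nonneg p.1
        positivity
    _ = (∑ f ∈ Finset.Icc (-(N : ℤ)) N ×ˢ Finset.Icc (-(N : ℤ)) N, 1 / (ldot f f : ℝ)) *
        harmonic N := by
        rw [Finset.sum_product, harmonic_cast_eq, Finset.sum_mul_sum]
    _ ≤ _ := by
        rw [mul_comm]
        exact mul_le_mul_of_nonneg_left (sum_box_one_div_ldot_self_le N) (harmonic_cast_nonneg N)

/-- Since `⌈D⌉ ≤ 2D`, the left side is at most `1 + log 2 + log D`; both `log 2 ≤ log D` and `1 ≤ 2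
log D` hold as `D ≥ 2`. -/
theorem harmonic_ceil_le {D : ℝ} (hD : 2 ≤ D) : (harmonic ⌈D⌉₊ : ℝ) ≤ 4 * Real.log D := by
  have h1 := harmonic_le_one_add_log ⌈D⌉₊
  have hpos : (0 : ℝ) < ⌈D⌉₊ := (by linarith : (0 : ℝ) < D).trans_le (Nat.le_ceil D)
  have h2 : Real.log ⌈D⌉₊ ≤ Real.log (2 * D) :=
    Real.log_le_log hpos (by have := Nat.ceil_lt_add_one (show 0 ≤ D by linarith); linarith)
  rw [Real.log_mul (by norm_num) (by linarith)] at h2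
  have h3 : Real.log 2 ≤ Real.log D := Real.log_le_log (by norm_num) hD
  have := Real.log_two_gt_d9
  linarith

/-- The sum, over the acute bases `(f, g)` of the lattice with sum of norm at most `D`, of the
bounds on the measures of refined angles. -/
theorem sum_parentPairs_le {D : ℝ} (hD : 2 ≤ D) (T : Finset IntVec) (F G : IntVec → IntVec)
    (hFG : ∀ e ∈ T, IsParentPair (F e) (G e) e) (hT : ∀ e ∈ T, (ldot e e : ℝ) ≤ D ^ 2) :
    ∑ e ∈ T, (1 / (ldot (F e) e : ℝ) + 1 / (ldot (G e) e : ℝ)) ≤ 384 * Real.log D ^ 2 := by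
  set M := ⌈D⌉₊ with hM
  have hT' : ∀ e ∈ T, ldot e e ≤ (M : ℤ) ^ 2 := by
    intro e he
    have h1 : D ^ 2 ≤ (M : ℝ) ^ 2 := pow_le_pow_left₀ (by linarith) (Nat.le_ceil D) 2
    exact_mod_cast (hT e he).trans h1
  have h1 := sum_one_div_ldot_parent_le M T F 1 (by norm_num) (fun e he => (hFG e he).ldet_left)
    (fun e he => (hFG e he).irreducible_left.ldot_self_pos) (fun e he => by
      rw [(hFG e he).ldot_left]; linarith [(hFG e he).ldot_nonneg]) hT'
  have h2 := sum_one_div_ldot_parent_le M T G (-1) (by norm_num) (fun e he => by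
      rw [ldet_swap, (hFG e he).ldet_right])
    (fun e he => (hFG e he).irreducible_right.ldot_self_pos) (fun e he => by
      rw [(hFG e he).ldot_right]; linarith [(hFG e he).ldot_nonneg]) hT'
  -- Each of the two parents contributes at most `12 · 4²` times `log² D`, whence `384`.
  have h3 := harmonic_ceil_le hD
  have h4 := harmonic_cast_nonneg M
  have h5 : (harmonic M : ℝ) * harmonic M ≤ (4 * Real.log D) * (4 * Real.log D) :=
    mul_le_mul h3 h3 h4 (h4.trans h3)
  rw [Finset.sum_add_distrib]
  linarith

/-! ### Measurability and unfolding over the lattice. -/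

theorem continuous_rotate : Continuous fun q : Plane × ℝ => rotate q.2 q.1 := by
  refine (PiLp.continuous_toLp 2 _).comp (continuous_pi fun i => ?_)
  fin_cases i
  · simp; fun_prop
  · simp; fun_prop

theorem continuous_shift (h : ℝ) (e : IntVec) :
    Continuous fun q : Plane × ℝ => shift h q.2 q.1 e := by
  have h1 : Continuous fun q : Plane × ℝ => rotate q.2 (latticeVec e) :=
    continuous_rotate.comp (continuous_const.prodMk continuous_snd)
  exact continuous_fst.add (h1.const_smul h)

theorem measurableSet_isRefined {O : Set Plane} (hO : IsOpen O) {U : Plane → ℝ}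
    (hU : ContinuousOn U O) (h : ℝ) (e : IntVec) :
    MeasurableSet {q : Plane × ℝ | IsRefined O U h e q.2 q.1} := by
  classical
  -- Nothing is known of `U` outside `O`; extension by zero is measurable, and the forms are
  -- evaluated only at points of `O`.
  set W : Plane → ℝ := O.piecewise U 0 with hW
  have hWm : Measurable W := ContinuousOn.measurable_piecewise hU continuousOn_const hO.measurableSet
  have hWU : ∀ x ∈ O, W x = U x := fun x hx => Set.piecewise_eq_of_mem _ _ _ hx
  have heq : {q : Plane × ℝ | IsRefined O U h e q.2 q.1} =
      {q | q.1 ∈ O} ∩ ({q | shift h q.2 q.1 e ∈ O} ∩ ⋂ f, ⋂ g, {q | IsParentPair f g e →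
        shift h q.2 q.1 f ∈ O → shift h q.2 q.1 g ∈ O →
          parallelogramForm h q.2 q.1 e f g W < 0}) := by
    ext q
    simp only [Set.mem_ofPred_eq, Set.mem_inter_iff, Set.mem_iInter, IsRefined]
    refine and_congr_right fun h1 => and_congr_right fun h2 => forall_congr' fun f =>
      forall_congr' fun g => forall_congr' fun _ => forall_congr' fun h3 => forall_congr' fun h4 =>
      ?_
    rw [parallelogramForm, parallelogramForm, hWU _ h1, hWU _ h2, hWU _ h3, hWU _ h4]
  have hsh : ∀ f, MeasurableSet {q : Plane × ℝ | shift h q.2 q.1 f ∈ O} := fun f =>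
    (hO.preimage (continuous_shift h f)).measurableSet
  rw [heq]
  refine (hO.preimage continuous_fst).measurableSet.inter ((hsh e).inter ?_)
  refine MeasurableSet.iInter fun f => MeasurableSet.iInter fun g => ?_
  refine (MeasurableSet.const _).imp ((hsh f).imp ((hsh g).imp ?_))
  refine measurableSet_lt ?_ measurable_const
  have hm : ∀ f, Measurable fun q : Plane × ℝ => W (shift h q.2 q.1 f) := fun f =>
    hWm.comp (continuous_shift h f).measurable
  exact (((hm e).sub (hm f)).sub (hm g)).add (hWm.comp measurable_fst)

theorem norm_rotate (θ : ℝ) (v : Plane) : ‖rotate θ v‖ = ‖v‖ := by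
  rw [EuclideanSpace.norm_eq, EuclideanSpace.norm_eq]
  congr 1
  simp only [Fin.sum_univ_two, Real.norm_eq_abs, sq_abs, rotate]
  simp
  linear_combination (v 0 ^ 2 + v 1 ^ 2) * Real.sin_sq_add_cos_sq θ

/-- The rotation of angle `θ` as a linear isometry equivalence. -/
noncomputable def rotateEquiv (θ : ℝ) : Plane ≃ₗᵢ[ℝ] Plane :=
  LinearIsometry.toLinearIsometryEquiv
    { toFun := rotate θ
      map_add' := rotate_add θ
      map_smul' := rotate_smul θ
      norm_map' := norm_rotate θ } rfl

theorem lintegral_comp_smul_rotate {h : ℝ} (hh : 0 < h) (θ : ℝ) {F : Plane → ENNReal}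
    (hF : Measurable F) :
    ∫⁻ y, F (h • rotate θ y) = ENNReal.ofReal (h ^ 2)⁻¹ * ∫⁻ x, F x := by
  have h1 : ∫⁻ y, F (h • rotate θ y) = ∫⁻ y, F (h • y) :=
    (rotateEquiv θ).measurePreserving.lintegral_comp (f := fun y => F (h • y))
      (hF.comp (measurable_const_smul h))
  have h2 : ∫⁻ y, F (h • y) = ∫⁻ x, F x ∂(Measure.map (h • ·) (volume : Measure Plane)) :=
    (lintegral_map hF (measurable_const_smul h)).symm
  rw [h1, h2, Measure.map_addHaar_smul _ hh.ne', lintegral_smul_measure, smul_eq_mul,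
    finrank_euclideanSpace_fin, abs_of_pos (by positivity)]

/-- The half-open unit square. -/
def halfOpenSquare : Set Plane := {ξ | ∀ i, ξ i ∈ Set.Ico (0 : ℝ) 1}

theorem unitSquare_ae_eq : unitSquare =ᵐ[volume] halfOpenSquare := by
  have h1 : (Set.pi Set.univ fun _ : Fin 2 => Set.Ico (0 : ℝ) 1) =ᵐ[volume]
      (Set.pi Set.univ fun _ : Fin 2 => Set.Icc (0 : ℝ) 1) := by
    rw [volume_pi]
    exact Measure.pi_Ico_ae_eq_pi_Icc
  have h2 := (PiLp.volume_preserving_ofLp (Fin 2)).quasiMeasurePreserving.preimage_ae_eq h1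
  have h3 : unitSquare = (WithLp.ofLp (p := 2)) ⁻¹'
      (Set.pi Set.univ fun _ : Fin 2 => Set.Icc (0 : ℝ) 1) := by
    ext ξ; simp only [unitSquare, Set.mem_ofPred_eq, Set.mem_preimage, Set.mem_pi, Set.mem_univ,
      true_imp_iff]
  have h4 : halfOpenSquare = (WithLp.ofLp (p := 2)) ⁻¹'
      (Set.pi Set.univ fun _ : Fin 2 => Set.Ico (0 : ℝ) 1) := by
    ext ξ; simp only [halfOpenSquare, Set.mem_ofPred_eq, Set.mem_preimage, Set.mem_pi, Set.mem_univ,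
      true_imp_iff]
  rw [h3, h4]
  exact h2.symm

theorem measurable_coord (i : Fin 2) : Measurable fun ξ : Plane => ξ i := by
  exact (measurable_pi_apply i).comp (WithLp.measurable_ofLp 2 _)

theorem measurableSet_halfOpenSquare : MeasurableSet halfOpenSquare := by
  have : halfOpenSquare = ⋂ i, (fun ξ : Plane => ξ i) ⁻¹' Set.Ico (0 : ℝ) 1 := by
    ext ξ; simp [halfOpenSquare]
  rw [this]
  exact MeasurableSet.iInter fun i => measurable_coord i measurableSet_Ico

/-- The half-open square is an exact fundamental domain, so each point lies in a single lattice
translate; the closed square has this only up to a null set. -/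
theorem sub_latticeVec_mem_halfOpenSquare_iff (x : Plane) (k : IntVec) :
    x - latticeVec k ∈ halfOpenSquare ↔ k = (⌊x 0⌋, ⌊x 1⌋) := by
  simp only [halfOpenSquare, Set.mem_ofPred_eq, Fin.forall_fin_two, Set.mem_Ico, Prod.ext_iff]
  rw [eq_comm (a := k.1), eq_comm (a := k.2), Int.floor_eq_iff, Int.floor_eq_iff]
  simp only [latticeVec, PiLp.sub_apply, Matrix.cons_val_zero, Matrix.cons_val_one]
  constructor
  · rintro ⟨⟨h1, h2⟩, h3, h4⟩
    exact ⟨⟨by linarith, by linarith⟩, by linarith, by linarith⟩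
  · rintro ⟨⟨h1, h2⟩, h3, h4⟩
    exact ⟨⟨by linarith, by linarith⟩, by linarith, by linarith⟩

/-- The integrals over the unit square of the lattice translates of a function add up to its
integral over the plane. -/
theorem tsum_setLIntegral_unitSquare {F : Plane → ENNReal} (hF : Measurable F) :
    ∑' k : IntVec, ∫⁻ ξ in unitSquare, F (ξ + latticeVec k) = ∫⁻ x, F x := by
  have h1 : ∀ k : IntVec, ∫⁻ ξ in unitSquare, F (ξ + latticeVec k) =
      ∫⁻ x, halfOpenSquare.indicator 1 (x - latticeVec k) * F x := by
    intro k
    rw [Measure.restrict_congr_set unitSquare_ae_eq,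
      ← lintegral_indicator measurableSet_halfOpenSquare,
      ← lintegral_sub_right_eq_self _ (latticeVec k)]
    refine lintegral_congr fun x => ?_
    by_cases hx : x - latticeVec k ∈ halfOpenSquare
    · rw [Set.indicator_of_mem hx, Set.indicator_of_mem hx, sub_add_cancel, Pi.one_apply, one_mul]
    · rw [Set.indicator_of_notMem hx, Set.indicator_of_notMem hx, zero_mul]
  simp only [h1]
  rw [← lintegral_tsum]
  · refine lintegral_congr fun x => ?_
    rw [tsum_eq_single ((⌊x 0⌋, ⌊x 1⌋) : IntVec)]
    · rw [Set.indicator_of_mem ((sub_latticeVec_mem_halfOpenSquare_iff x _).2 rfl), Pi.one_apply,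
        one_mul]
    · intro k hk
      rw [Set.indicator_of_notMem fun hm => hk ((sub_latticeVec_mem_halfOpenSquare_iff x k).1 hm),
        zero_mul]
  · intro k
    exact ((((measurable_one).indicator measurableSet_halfOpenSquare).comp
      (measurable_id.sub_const _)).mul hF).aemeasurable

/-! ### The measure of refined pairs. -/

/-- The measure of the refined pairs `(x, θ)` for a given offset. -/
noncomputable def refinedMeasure (O : Set Plane) (U : Plane → ℝ) (h : ℝ) (e : IntVec) : ENNReal :=
  ∫⁻ θ in Set.Icc (0 : ℝ) (Real.pi / 2), volume {x | IsRefined O U h e θ x}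

theorem refinedMeasure_le (O : Set Plane) (U : Plane → ℝ) (h : ℝ) (e : IntVec) :
    refinedMeasure O U h e ≤ volume O * ENNReal.ofReal (Real.pi / 2) := by
  calc refinedMeasure O U h e ≤ ∫⁻ _ in Set.Icc (0 : ℝ) (Real.pi / 2), volume O :=
        lintegral_mono fun θ => measure_mono fun x hx => hx.1
    _ = _ := by rw [setLIntegral_const, Real.volume_Icc, sub_zero]

/-- Translation by `(h/2) R_θ e` replaces `x` by the centre of its segment, and Tonelli then puts
the integral over angles inside, where the centre is fixed. -/
theorem refinedMeasure_eq_lintegral_centers {O : Set Plane} (hO : IsOpen O) {U : Plane → ℝ}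
    (hU : ContinuousOn U O) (h : ℝ) (e : IntVec) :
    refinedMeasure O U h e = ∫⁻ c, volume {θ ∈ Set.Icc (0 : ℝ) (Real.pi / 2) |
      IsRefined O U h e θ (c - (h / 2) • rotate θ (latticeVec e))} := by
  set Z : Set (Plane × ℝ) :=
    {q | IsRefined O U h e q.2 (q.1 - (h / 2) • rotate q.2 (latticeVec e))} with hZ
  have hcont : Continuous fun q : Plane × ℝ =>
      (q.1 - (h / 2) • rotate q.2 (latticeVec e), q.2) := by
    have h1 : Continuous fun q : Plane × ℝ => rotate q.2 (latticeVec e) :=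
      continuous_rotate.comp (continuous_const.prodMk continuous_snd)
    exact (continuous_fst.sub (h1.const_smul (h / 2))).prodMk continuous_snd
  have hZm : MeasurableSet Z := hcont.measurable (measurableSet_isRefined hO hU h e)
  have h1 : refinedMeasure O U h e =
      ∫⁻ θ in Set.Icc (0 : ℝ) (Real.pi / 2), ∫⁻ c, Z.indicator 1 (c, θ) := by
    refine lintegral_congr fun θ => ?_
    have hm : MeasurableSet {x | IsRefined O U h e θ x} :=
      measurable_prodMk_right (measurableSet_isRefined hO hU h e)
    rw [← lintegral_indicator_one hm,
      ← lintegral_sub_right_eq_self _ ((h / 2) • rotate θ (latticeVec e))]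
    rfl
  rw [h1, lintegral_lintegral_swap]
  · refine lintegral_congr fun c => ?_
    have hm : MeasurableSet {θ | (c, θ) ∈ Z} := measurable_prodMk_left hZm
    have : ∀ θ, Z.indicator (1 : Plane × ℝ → ENNReal) (c, θ) =
      {θ | (c, θ) ∈ Z}.indicator 1 θ := fun θ => rfl
    simp only [this]
    rw [lintegral_indicator_one hm, Measure.restrict_apply hm, Set.inter_comm]
    rfl
  · exact ((measurable_one.indicator hZm).comp measurable_swap).aemeasurable

theorem refinedMeasure_le_of_isParentPair {O : Set Plane} (hO : IsOpen O) {U : Plane → ℝ}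
    (hU : ConvexOn ℝ O U) (hUc : ContinuousOn U O) (h : ℝ) {e f g : IntVec}
    (hp : IsParentPair f g e) :
    refinedMeasure O U h e ≤
      volume O * ENNReal.ofReal (Real.pi * (1 / ldot f e + 1 / ldot g e)) := by
  rw [refinedMeasure_eq_lintegral_centers hO hUc, mul_comm, ← setLIntegral_const,
    ← lintegral_indicator hO.measurableSet]
  refine lintegral_mono fun c => ?_
  by_cases hc : c ∈ O
  · rw [Set.indicator_of_mem hc]
    exact volume_refined_angles_le hU hp c
  -- A centre is the midpoint of two points of the convex set `O`, hence lies in `O`.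
  · rw [Set.indicator_of_notMem hc, nonpos_iff_eq_zero]
    convert measure_empty (μ := volume)
    refine Set.eq_empty_of_forall_notMem ?_
    rintro θ ⟨-, h1, h2, -⟩
    refine hc ?_
    have := hU.1 h1 h2 (show (0 : ℝ) ≤ 1 / 2 by norm_num) (show (0 : ℝ) ≤ 1 / 2 by norm_num)
      (by norm_num)
    convert this using 1
    simp only [shift]
    module

theorem norm_latticeVec_sq (e : IntVec) : ‖latticeVec e‖ ^ 2 = ldot e e := by
  rw [EuclideanSpace.norm_sq_eq]
  simp [latticeVec, ldot, Fin.sum_univ_two]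
  ring

theorem ldot_self_le_of_shift_mem {Ω : Set Plane} (hΩ : Bornology.IsBounded Ω) {h : ℝ}
    (hh : 0 < h) {θ : ℝ} {x : Plane} {e : IntVec} (hx : x ∈ Ω) (he : shift h θ x e ∈ Ω) :
    (ldot e e : ℝ) ≤ (Metric.diam Ω / h) ^ 2 := by
  have h1 := Metric.dist_le_diam_of_mem hΩ he hx
  rw [dist_eq_norm, shift, add_sub_cancel_left, norm_smul, norm_rotate, Real.norm_eq_abs,
    abs_of_pos hh] at h1
  rw [← norm_latticeVec_sq]
  refine pow_le_pow_left₀ (norm_nonneg _) ?_ 2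
  rw [le_div_iff₀ hh]; linarith

theorem refinedMeasure_eq_zero {O Ω : Set Plane} (hΩ : Bornology.IsBounded Ω) (hOΩ : O ⊆ Ω)
    (U : Plane → ℝ) {h : ℝ} (hh : 0 < h) {e : IntVec}
    (he : (Metric.diam Ω / h) ^ 2 < (ldot e e : ℝ)) : refinedMeasure O U h e = 0 := by
  rw [refinedMeasure]
  have : ∀ θ, {x | IsRefined O U h e θ x} = ∅ := fun θ => by
    refine Set.eq_empty_of_forall_notMem fun x hx => ?_
    exact absurd (ldot_self_le_of_shift_mem hΩ hh (hOΩ hx.1) (hOΩ hx.2.1)) (not_le.2 he)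
  simp [this]

-- Vectors longer than `D = diam Ω / h` contribute nothing. Unit vectors get the trivial bound on
-- the measure, the others the bound on angles summed over acute bases.
open Classical in
theorem tsum_refinedMeasure_le {Ω O : Set Plane} (hΩ : Bornology.IsBounded Ω) (hOΩ : O ⊆ Ω)
    (hO : IsOpen O) {U : Plane → ℝ} (hU : ConvexOn ℝ O U) (hUc : ContinuousOn U O) {h : ℝ}
    (hh : 0 < h) (hD : 2 ≤ Metric.diam Ω / h) :
    ∑' e : IntVec, (if IrreducibleVec e then refinedMeasure O U h e else 0) ≤
      volume O * ENNReal.ofReal (402 * Real.pi * Real.log (Metric.diam Ω / h) ^ 2) := by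
  set D := Metric.diam Ω / h with hDdef
  set N := ⌈D⌉₊ with hN
  have hDN : D ^ 2 ≤ (N : ℝ) ^ 2 := pow_le_pow_left₀ (by linarith) (Nat.le_ceil D) 2
  set T₀ : Finset IntVec := (Finset.Icc (-(N : ℤ)) N ×ˢ Finset.Icc (-(N : ℤ)) N).filter
    fun e => IrreducibleVec e ∧ (ldot e e : ℝ) ≤ D ^ 2 with hT₀
  have hsum : ∑' e : IntVec, (if IrreducibleVec e then refinedMeasure O U h e else 0) =
      ∑ e ∈ T₀, refinedMeasure O U h e := by
    rw [tsum_eq_sum (s := T₀)]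
    · refine Finset.sum_congr rfl fun e he => ?_
      rw [if_pos (Finset.mem_filter.1 he).2.1]
    · intro e he
      split_ifs with hirr
      · refine refinedMeasure_eq_zero hΩ hOΩ U hh ?_
        by_contra! hle
        refine he (Finset.mem_filter.2 ⟨mem_Icc_of_ldot_self_le ?_, hirr, hle⟩)
        exact_mod_cast hle.trans hDN
      · rfl
  have hirr : ∀ e ∈ T₀, IrreducibleVec e := fun e he => (Finset.mem_filter.1 he).2.1
  have hle : ∀ e ∈ T₀, (ldot e e : ℝ) ≤ D ^ 2 := fun e he => (Finset.mem_filter.1 he).2.2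
  set T₁ := T₀.filter fun e => ldot e e ≤ 1 with hT₁
  set T₂ := T₀.filter fun e => ¬ ldot e e ≤ 1 with hT₂
  have hpar : ∀ e : IntVec, ∃ p : IntVec × IntVec, e ∈ T₂ → IsParentPair p.1 p.2 e := by
    intro e
    by_cases he : e ∈ T₂
    · have he' := Finset.mem_filter.1 he
      obtain ⟨f, g, hp⟩ := exists_isParentPair (hirr e he'.1) (not_le.1 he'.2)
      exact ⟨(f, g), fun _ => hp⟩
    · exact ⟨0, fun h => absurd h he⟩
  choose P hP using hpar
  have h1 : ∑ e ∈ T₁, refinedMeasure O U h e ≤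
      volume O * ENNReal.ofReal (9 * (Real.pi / 2)) := by
    -- The crude count of the points of the box `[-1, 1]²`.
    have hcard : T₁.card ≤ 9 := by
      have hsub : T₁ ⊆ Finset.Icc (-((1 : ℕ) : ℤ)) (1 : ℕ) ×ˢ Finset.Icc (-((1 : ℕ) : ℤ)) (1 : ℕ) :=
        fun e he => mem_Icc_of_ldot_self_le (by
          have := (Finset.mem_filter.1 he).2; push_cast; linarith)
      exact (Finset.card_le_card hsub).trans (by decide)
    calc _ ≤ ∑ e ∈ T₁, volume O * ENNReal.ofReal (Real.pi / 2) :=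
          Finset.sum_le_sum fun e _ => refinedMeasure_le O U h e
      _ = T₁.card * (volume O * ENNReal.ofReal (Real.pi / 2)) := by
          rw [Finset.sum_const, nsmul_eq_mul]
      _ ≤ 9 * (volume O * ENNReal.ofReal (Real.pi / 2)) := by
          gcongr; exact_mod_cast hcard
      _ = _ := by
          rw [ENNReal.ofReal_mul (by norm_num), ENNReal.ofReal_ofNat]; ring
  have h2 : ∑ e ∈ T₂, refinedMeasure O U h e ≤
      volume O * ENNReal.ofReal (Real.pi * (384 * Real.log D ^ 2)) := by
    have hS := sum_parentPairs_le hD T₂ (fun e => (P e).1) (fun e => (P e).2) hP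
      fun e he => hle e (Finset.mem_filter.1 he).1
    calc _ ≤ ∑ e ∈ T₂, volume O * ENNReal.ofReal
          (Real.pi * (1 / ldot (P e).1 e + 1 / ldot (P e).2 e)) :=
          Finset.sum_le_sum fun e he => refinedMeasure_le_of_isParentPair hO hU hUc h (hP e he)
      _ = volume O * ENNReal.ofReal (∑ e ∈ T₂,
          Real.pi * (1 / ldot (P e).1 e + 1 / ldot (P e).2 e)) := by
          rw [← Finset.mul_sum, ENNReal.ofReal_sum_of_nonneg]
          intro e he
          have a1 : (0 : ℝ) < ldot (P e).1 e := by exact_mod_cast (hP e he).ldot_left_pos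
          have a2 : (0 : ℝ) < ldot (P e).2 e := by exact_mod_cast (hP e he).ldot_right_pos
          positivity
      _ ≤ _ := by
          rw [← Finset.mul_sum]
          gcongr
  rw [hsum, ← Finset.sum_filter_add_sum_filter_not T₀ fun e => ldot e e ≤ 1]
  refine (add_le_add h1 h2).trans ?_
  rw [← mul_add, ← ENNReal.ofReal_add (by positivity) (by positivity)]
  gcongr
  -- The short vectors contribute `9π/2 ≤ 18 π log² D`, and `18 + 384 = 402`.
  have hlog : (1 : ℝ) / 2 ≤ Real.log D := by
    have := Real.log_le_log (by norm_num) hD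
    have := Real.log_two_gt_d9
    linarith
  have hlog2 : 1 ≤ 4 * Real.log D ^ 2 := by nlinarith
  nlinarith [Real.pi_pos, mul_le_mul_of_nonneg_left hlog2 Real.pi_pos.le]

/-! ### Indexing the refined pairs by the lattice. -/

/-- The point of index `k` of the grid. -/
noncomputable def gridPoint (h θ : ℝ) (ξ : Plane) (k : IntVec) : Plane := h • rotate θ (ξ + latticeVec k)

theorem rotate_injective (θ : ℝ) : Function.Injective (rotate θ) := (rotateEquiv θ).injective

theorem gridPoint_injective {h : ℝ} (hh : 0 < h) (θ : ℝ) (ξ : Plane) :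
    Function.Injective (gridPoint h θ ξ) := by
  intro k l hkl
  exact latticeVec_injective
    (add_left_cancel (rotate_injective θ (smul_right_injective Plane hh.ne' hkl)))

theorem shift_gridPoint (h θ : ℝ) (ξ : Plane) (k e : IntVec) :
    shift h θ (gridPoint h θ ξ k) e = gridPoint h θ ξ (k + e) := by
  simp only [shift, gridPoint, latticeVec_add, rotate_add, smul_add, add_assoc]

theorem refinementStencils_eq_image {Ω : Set Plane} {h θ : ℝ} {ξ : Plane} {U : Plane → ℝ} :
    refinementStencils Ω h θ ξ U = (fun p : IntVec × IntVec => (gridPoint h θ ξ p.1, p.2)) ''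
      {p | IrreducibleVec p.2 ∧ IsRefined Ω U h p.2 θ (gridPoint h θ ξ p.1)} := by
  ext ⟨x, e⟩
  constructor
  · rintro ⟨⟨⟨hx, k, hk⟩, hirr, hs⟩, hneg⟩
    have hk' : x = gridPoint h θ ξ k := hk
    subst hk'
    exact ⟨(k, e), ⟨hirr, hx, hs.1, hneg⟩, rfl⟩
  · rintro ⟨⟨k, e'⟩, ⟨hirr, hx, hs, hneg⟩, heq⟩
    obtain ⟨rfl, rfl⟩ := Prod.mk.inj heq
    have hg : gridPoint h θ ξ k ∈ gridPoints Ω h θ ξ := ⟨hx, k, rfl⟩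
    exact ⟨⟨hg, hirr, shift_mem_gridPoints hg hs⟩, hneg⟩

theorem finite_gridIndices {Ω : Set Plane} (hΩ : Bornology.IsBounded Ω) {h : ℝ} (hh : 0 < h)
    (θ : ℝ) (ξ : Plane) : {k | gridPoint h θ ξ k ∈ Ω}.Finite := by
  obtain ⟨R, hR⟩ := hΩ.exists_norm_le
  obtain ⟨N, hN⟩ := exists_nat_ge (R / h + ‖ξ‖)
  refine (Finset.finite_toSet (Finset.Icc (-(N : ℤ)) N ×ˢ Finset.Icc (-(N : ℤ)) N)).subset ?_
  intro k hk
  refine Finset.mem_coe.2 (mem_Icc_of_ldot_self_le ?_)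
  have h1 := hR _ hk
  rw [gridPoint, norm_smul, norm_rotate, Real.norm_eq_abs, abs_of_pos hh] at h1
  have h2 : ‖latticeVec k‖ ≤ N := by
    have h3 : ‖latticeVec k‖ ≤ ‖ξ + latticeVec k‖ + ‖ξ‖ := by
      simpa using norm_sub_le (ξ + latticeVec k) ξ
    have h4 : ‖ξ + latticeVec k‖ ≤ R / h := by rw [le_div_iff₀ hh]; linarith
    linarith
  have h5 : (ldot k k : ℝ) ≤ (N : ℝ) ^ 2 := by
    rw [← norm_latticeVec_sq]
    exact pow_le_pow_left₀ (norm_nonneg _) h2 2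
  exact_mod_cast h5

theorem finite_refinedIndices {Ω : Set Plane} (hΩ : Bornology.IsBounded Ω) {h : ℝ} (hh : 0 < h)
    (θ : ℝ) (ξ : Plane) (U : Plane → ℝ) :
    {p : IntVec × IntVec | IrreducibleVec p.2 ∧
      IsRefined Ω U h p.2 θ (gridPoint h θ ξ p.1)}.Finite := by
  have hfin := finite_gridIndices hΩ hh θ ξ
  refine ((hfin.prod hfin).image fun q : IntVec × IntVec => (q.1, q.2 - q.1)).subset ?_
  rintro ⟨k, e⟩ ⟨-, h1, h2, -⟩
  refine ⟨(k, k + e), ⟨h1, ?_⟩, by simp⟩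
  rw [shift_gridPoint] at h2
  exact h2

theorem finite_refinementStencils {Ω : Set Plane} (hΩ : Bornology.IsBounded Ω) {h : ℝ}
    (hh : 0 < h) (θ : ℝ) (ξ : Plane) (U : Plane → ℝ) :
    (refinementStencils Ω h θ ξ U).Finite := by
  rw [refinementStencils_eq_image]
  exact (finite_refinedIndices hΩ hh θ ξ U).image _

/-! ### The count and its average over rotations and offsets. -/

/-- The number of refined pairs for given rotation and offset, as an extended real. -/
noncomputable def refinedCount (O : Set Plane) (U : Plane → ℝ) (h : ℝ) (p : Plane × ℝ) : ENNReal :=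
  ∑' q : IntVec × IntVec, {p : Plane × ℝ | IrreducibleVec q.2 ∧
    IsRefined O U h q.2 p.2 (gridPoint h p.2 p.1 q.1)}.indicator 1 p

theorem continuous_gridPoint (h : ℝ) (k : IntVec) :
    Continuous fun p : Plane × ℝ => gridPoint h p.2 p.1 k := by
  have h1 : Continuous fun q : Plane × ℝ => rotate q.2 (q.1 + latticeVec k) :=
    continuous_rotate.comp ((continuous_fst.add continuous_const).prodMk continuous_snd)
  exact h1.const_smul h

theorem measurableSet_isRefined_gridPoint {O : Set Plane} (hO : IsOpen O) {U : Plane → ℝ}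
    (hU : ContinuousOn U O) (h : ℝ) (k e : IntVec) :
    MeasurableSet {p : Plane × ℝ | IrreducibleVec e ∧
      IsRefined O U h e p.2 (gridPoint h p.2 p.1 k)} := by
  refine (MeasurableSet.const _).inter ?_
  exact ((continuous_gridPoint h k).prodMk continuous_snd).measurable
    (measurableSet_isRefined hO hU h e)

theorem measurable_refinedCount {O : Set Plane} (hO : IsOpen O) {U : Plane → ℝ}
    (hU : ContinuousOn U O) (h : ℝ) : Measurable (refinedCount O U h) := by
  refine Measurable.tsum fun q => ?_
  exact measurable_one.indicator (measurableSet_isRefined_gridPoint hO hU h q.1 q.2)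

theorem refinedCount_eq {Ω : Set Plane} (hΩ : Bornology.IsBounded Ω) {h : ℝ} (hh : 0 < h)
    (U : Plane → ℝ) (p : Plane × ℝ) :
    refinedCount Ω U h p = ((refinementStencils Ω h p.2 p.1 U).ncard : ENNReal) := by
  have hinj : Function.Injective
      (fun q : IntVec × IntVec => (gridPoint h p.2 p.1 q.1, q.2)) := by
    intro q r hqr
    simp only [Prod.mk.injEq] at hqr
    exact Prod.ext (gridPoint_injective hh _ _ hqr.1) hqr.2
  rw [refinementStencils_eq_image, Set.ncard_image_of_injective _ hinj]
  set S : Set (IntVec × IntVec) := {q | IrreducibleVec q.2 ∧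
      IsRefined Ω U h q.2 p.2 (gridPoint h p.2 p.1 q.1)} with hS
  have hfin : S.Finite := finite_refinedIndices hΩ hh p.2 p.1 U
  have h1 : refinedCount Ω U h p = ∑' q, S.indicator (fun _ => (1 : ENNReal)) q := rfl
  rw [h1, ← tsum_subtype, ENNReal.tsum_set_one, ← hfin.cast_ncard_eq]
  rfl

/-- Almost surely, the grid avoids the boundary of a convex set. -/
theorem ae_gridPoint_notMem_frontier {Ω : Set Plane} (hΩ : Convex ℝ Ω) {h : ℝ} (hh : 0 < h) :
    ∀ᵐ p : Plane × ℝ, ∀ k, gridPoint h p.2 p.1 k ∉ frontier Ω := by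
  rw [ae_all_iff]
  intro k
  have hm : MeasurableSet {p : Plane × ℝ | gridPoint h p.2 p.1 k ∈ frontier Ω} :=
    (isClosed_frontier.preimage (continuous_gridPoint h k)).measurableSet
  have h0 : (volume : Measure (Plane × ℝ))
      {p : Plane × ℝ | gridPoint h p.2 p.1 k ∈ frontier Ω} = 0 := by
    rw [Measure.volume_eq_prod, Measure.prod_apply_symm hm]
    refine (lintegral_congr fun θ => ?_).trans lintegral_zero
    have hF : Measurable ((frontier Ω).indicator (1 : Plane → ENNReal)) :=
      measurable_one.indicator isClosed_frontier.measurableSet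
    have h2 := lintegral_comp_smul_rotate hh θ hF
    -- The boundary of a convex set is a null set, so for each angle almost every offset avoids it.
    rw [lintegral_indicator_one isClosed_frontier.measurableSet, hΩ.addHaar_frontier volume, mul_zero,
      ← lintegral_add_right_eq_self _ (latticeVec k)] at h2
    rw [← h2, ← lintegral_indicator_one (measurable_prodMk_right hm)]
    rfl
  exact measure_eq_zero_iff_ae_notMem.1 h0

theorem indicator_one_eq_of_mem_iff {α β : Type*} {s : Set α} {t : Set β} {a : α} {b : β}
    (hst : a ∈ s ↔ b ∈ t) : s.indicator (1 : α → ENNReal) a = t.indicator 1 b := by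
  by_cases ha : a ∈ s
  · rw [Set.indicator_of_mem ha, Set.indicator_of_mem (hst.1 ha), Pi.one_apply, Pi.one_apply]
  · rw [Set.indicator_of_notMem ha, Set.indicator_of_notMem fun hb => ha (hst.2 hb)]

/-- A convex function is continuous in the interior but may be irregular on the boundary. For almost
every grid no point lies on the boundary, so passing to the interior changes neither the points nor
the availability of parents. -/
theorem refinedCount_interior_ae_eq {Ω : Set Plane} (hΩ : Convex ℝ Ω) (hcl : IsClosed Ω) {h : ℝ}
    (hh : 0 < h) (U : Plane → ℝ) :
    refinedCount (interior Ω) U h =ᵐ[volume] refinedCount Ω U h := by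
  filter_upwards [ae_gridPoint_notMem_frontier hΩ hh] with p hp
  have hmem : ∀ k, gridPoint h p.2 p.1 k ∈ interior Ω ↔ gridPoint h p.2 p.1 k ∈ Ω := by
    intro k
    refine ⟨fun hk => interior_subset hk, fun hk => ?_⟩
    by_contra hni
    exact hp k (by rw [hcl.frontier_eq]; exact ⟨hk, hni⟩)
  refine tsum_congr fun q => ?_
  have hiff : IsRefined (interior Ω) U h q.2 p.2 (gridPoint h p.2 p.1 q.1) ↔
      IsRefined Ω U h q.2 p.2 (gridPoint h p.2 p.1 q.1) := by
    simp only [IsRefined, shift_gridPoint, hmem]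
  exact indicator_one_eq_of_mem_iff (and_congr_right fun _ => hiff)

/-- For a fixed angle and offset `e`, the lattice translates of the unit square tile the plane, and
the change of variables `x = h R_θ y` produces the factor `h⁻²`. -/
theorem lintegral_refinedCount_le {O : Set Plane} (hO : IsOpen O) {U : Plane → ℝ}
    (hU : ContinuousOn U O) {h : ℝ} (hh : 0 < h) [DecidablePred IrreducibleVec] :
    ∫⁻ p in unitSquare ×ˢ Set.Icc (0 : ℝ) (Real.pi / 2), refinedCount O U h p ≤
      ENNReal.ofReal (h ^ 2)⁻¹ *
        ∑' e : IntVec, (if IrreducibleVec e then refinedMeasure O U h e else 0) := by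
  set I := Set.Icc (0 : ℝ) (Real.pi / 2) with hI
  set Z : IntVec → IntVec → Set (Plane × ℝ) := fun k e => {p | IrreducibleVec e ∧
    IsRefined O U h e p.2 (gridPoint h p.2 p.1 k)} with hZ
  have hZm : ∀ k e, MeasurableSet (Z k e) := fun k e =>
    measurableSet_isRefined_gridPoint hO hU h k e
  have hind : ∀ k e, Measurable ((Z k e).indicator (1 : Plane × ℝ → ENNReal)) := fun k e =>
    measurable_one.indicator (hZm k e)
  have h1 : ∫⁻ p in unitSquare ×ˢ I, refinedCount O U h p =
      ∑' e : IntVec, ∑' k : IntVec, ∫⁻ p in unitSquare ×ˢ I, (Z k e).indicator 1 p := by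
    have h0 : ∫⁻ p in unitSquare ×ˢ I, refinedCount O U h p =
        ∫⁻ p in unitSquare ×ˢ I, ∑' q : IntVec × IntVec, (Z q.1 q.2).indicator 1 p := rfl
    rw [h0, lintegral_tsum fun q : IntVec × IntVec => (hind q.1 q.2).aemeasurable, ENNReal.tsum_prod',
      ENNReal.tsum_comm]
  rw [h1, ← ENNReal.tsum_mul_left]
  refine ENNReal.tsum_le_tsum fun e => ?_
  by_cases he : IrreducibleVec e
  swap
  · have : ∀ k, Z k e = ∅ := fun k => Set.eq_empty_of_forall_notMem fun p hp => he hp.1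
    simp [this]
  rw [if_pos he, refinedMeasure, ← lintegral_const_mul' _ _ ENNReal.ofReal_ne_top]
  have h2 : ∀ k, ∫⁻ p in unitSquare ×ˢ I, (Z k e).indicator 1 p =
      ∫⁻ θ in I, ∫⁻ ξ in unitSquare, (Z k e).indicator 1 (ξ, θ) := by
    intro k
    rw [Measure.volume_eq_prod, ← Measure.prod_restrict, lintegral_prod_symm' _ (hind k e)]
  simp only [h2]
  rw [← lintegral_tsum fun k => (hind k e).lintegral_prod_left'.aemeasurable]
  refine lintegral_mono fun θ => le_of_eq ?_
  have hm : MeasurableSet {x | IsRefined O U h e θ x} :=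
    measurable_prodMk_right (measurableSet_isRefined hO hU h e)
  have hF : Measurable ({x | IsRefined O U h e θ x}.indicator (1 : Plane → ENNReal)) :=
    measurable_one.indicator hm
  rw [← lintegral_indicator_one hm, ← lintegral_comp_smul_rotate hh θ hF]
  have hrot : Continuous fun y : Plane => h • rotate θ y :=
    (rotateEquiv θ).continuous.const_smul h
  refine Eq.trans ?_ (tsum_setLIntegral_unitSquare (hF.comp hrot.measurable))
  refine tsum_congr fun k => lintegral_congr fun ξ => ?_
  exact indicator_one_eq_of_mem_iff (and_iff_right he)

theorem mainTheorem6 :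
    ∃ C : ℝ, 0 < C ∧
      ∀ (h : ℝ) (Ω : Set Plane) (U : Plane → ℝ),
        0 < h → IsCompact Ω → Convex ℝ Ω → ConvexOn ℝ Ω U → 2 ≤ Metric.diam Ω / h →
          (∀ (θ : ℝ) (ξ : Plane),
            IsLeast (admissibleStencils Ω h θ ξ U) (minimalStencils Ω h θ ξ U) ∧
              (minimalStencils Ω h θ ξ U).Finite) ∧
          IntegrableOn (fun p : Plane × ℝ => ((minimalStencils Ω h p.2 p.1 U).ncard : ℝ))
            (unitSquare ×ˢ Set.Icc (0 : ℝ) (Real.pi / 2)) volume ∧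
          ∫ ξ in unitSquare, ∫ θ in (0 : ℝ)..(Real.pi / 2),
              ((minimalStencils Ω h θ ξ U).ncard : ℝ) ≤
            C * (volume.real Ω / h ^ 2) * Real.log (Metric.diam Ω / h) ^ 2 := by
  classical
  refine ⟨402 * Real.pi, by positivity, fun h Ω U hh hΩ hconv hU hD => ?_⟩
  have hO : IsOpen (interior Ω) := isOpen_interior
  have hOU : ConvexOn ℝ (interior Ω) U := hU.subset interior_subset hconv.interior
  have hUc : ContinuousOn U (interior Ω) := hU.continuousOn_interior
  set K := unitSquare ×ˢ Set.Icc (0 : ℝ) (Real.pi / 2) with hK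
  set B : ℝ := 402 * Real.pi * (volume.real Ω / h ^ 2) * Real.log (Metric.diam Ω / h) ^ 2 with hB
  have hB0 : 0 ≤ B := by positivity
  simp only [minimalStencils_eq hU]
  set n : Plane × ℝ → ℝ := fun p => ((refinementStencils Ω h p.2 p.1 U).ncard : ℝ) with hn
  have hcount : ∀ p, ENNReal.ofReal (n p) = refinedCount Ω U h p := fun p => by
    rw [refinedCount_eq hΩ.isBounded hh, ENNReal.ofReal_natCast]
  have hae : ∀ᵐ p ∂(volume.restrict K), ENNReal.ofReal (n p) = refinedCount (interior Ω) U h p := by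
    refine ae_restrict_of_ae ?_
    filter_upwards [refinedCount_interior_ae_eq hconv hΩ.isClosed hh U] with p hp
    rw [hcount, hp]
  have hn0 : ∀ p, 0 ≤ n p := fun p => Nat.cast_nonneg _
  have hbound : ∫⁻ p in K, ENNReal.ofReal (n p) ≤ ENNReal.ofReal B := by
    rw [lintegral_congr_ae hae]
    refine (lintegral_refinedCount_le hO hUc hh).trans ?_
    refine (mul_le_mul_right (tsum_refinedMeasure_le hΩ.isBounded interior_subset hO hOU hUc hh hD)
      _).trans ?_
    have hvol : volume (interior Ω) ≤ ENNReal.ofReal (volume.real Ω) := by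
      rw [Measure.real, ENNReal.ofReal_toReal hΩ.measure_lt_top.ne]
      exact measure_mono interior_subset
    calc _ ≤ ENNReal.ofReal (h ^ 2)⁻¹ * (ENNReal.ofReal (volume.real Ω) *
          ENNReal.ofReal (402 * Real.pi * Real.log (Metric.diam Ω / h) ^ 2)) := by gcongr
      _ = ENNReal.ofReal B := by
          rw [← ENNReal.ofReal_mul (by positivity), ← ENNReal.ofReal_mul (by positivity), hB]
          congr 1
          field_simp
  -- The count itself need not be measurable; it agrees almost everywhere with the measurable count
  -- for the interior.
  have hmeas : AEStronglyMeasurable n (volume.restrict K) := by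
    refine AEMeasurable.aestronglyMeasurable
      ⟨fun p => (refinedCount (interior Ω) U h p).toReal,
        (measurable_refinedCount hO hUc h).ennreal_toReal, ?_⟩
    filter_upwards [hae] with p hp
    rw [← hp, ENNReal.toReal_ofReal (hn0 p)]
  have hint : IntegrableOn n K volume := by
    refine ⟨hmeas, ?_⟩
    rw [hasFiniteIntegral_iff_ofReal (Filter.Eventually.of_forall hn0)]
    exact hbound.trans_lt ENNReal.ofReal_lt_top
  refine ⟨fun θ ξ => ⟨isLeast_refinementStencils hU, finite_refinementStencils hΩ.isBounded hh θ ξ U⟩,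
    hint, ?_⟩
  have hprod : ∫ ξ in unitSquare, ∫ θ in (0 : ℝ)..(Real.pi / 2),
      ((refinementStencils Ω h θ ξ U).ncard : ℝ) = ∫ p in K, n p := by
    rw [Measure.volume_eq_prod, hK, setIntegral_prod _ hint]
    refine integral_congr_ae (Filter.Eventually.of_forall fun ξ => ?_)
    simp only
    rw [intervalIntegral.integral_of_le (by positivity), integral_Icc_eq_integral_Ioc]
  rw [hprod, integral_eq_lintegral_of_nonneg_ae (Filter.Eventually.of_forall hn0) hmeas]
  exact ENNReal.toReal_le_of_le_ofReal hB0 hbound
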